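/- **Notation.** Families are finite and indexed (repetitions are allowed), and $|\cdot|$ is Lebesgue measure on $\mathbb R^3$ or cardinality. The *dimensions* $d_1\le d_2\le d_3$ of a convex set $V\subset\mathbb R^3$ are the lengths of the axes of its outer John ellipsoid (the ellipsoid of least volume containing $V$), and $\delta(V)=d_1/d_3$. A *shading* $Y$ of a family $\mathbb V$ assigns to each $V\in\mathbb V$ a measurable set $Y(V)\subset V$. Put $U(\mathbb V,Y)=\bigcup_{V\in\mathbb V}Y(V)$, $$\lambda(\mathbb V,Y)=\frac{\sum_{\mathbb V}|Y(V)|}{\sum_{\mathbb V}|V|},\qquad \mu(\mathbb V,Y)=\frac{\sum_{\mathbb V}|Y(V)|}{|U(\mathbb V,Y)|},\qquad \mathbb V_Y(x)=\{V\in\mathbb V: x\in Y(V)\}$$ (with $0/0=0$). Let $\Delta(\mathbb V,K)=|K|^{-1}\sum_{V\in\mathbb V,\,V\subset K}|V|$. The family $\mathbb V$ is *$C$-Frostman in* $K$ if $\sup_{K'}\Delta(\mathbb V,K')\le C\,\Delta(\mathbb V,K)$, the supremum being over the convex sets $K'\subset K$. Finally, $N_r(S)$ is the open $r$-neighbourhood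 of $S$. **Proposition.** There is an absolute constant $K_0$, and for every $A\ge1$ and $\epsilon>0$ there is a constant $K_{A,\epsilon}$, such that the following holds. Let $\mathbb V=\bigsqcup_{W\in\mathbb W}\mathbb V_W$, where $\mathbb V$ and $\mathbb W$ are finite families of convex sets in $\mathbb R^3$, every $V\in\mathbb V_W$ is contained in $W$, and each $\mathbb V_W$ is $C$-Frostman in $W$. Suppose that, up to the factor $A$, all $V\in\mathbb V$ have the same dimensions $v_1\times v_2\times v_3$ and all $W\in\mathbb W$ have the same dimensions $w_1\times w_2\times w_3$. Let $Y$ be a shading of $\mathbb V$, and let $0<\rho\le\min\bigl(|\mathbb V|^{-1},\min_{V\in\mathbb V}\delta(V)\bigr)$. Write $X\lessapprox X'$ if $X\le K_{A,\epsilon}\,\rho^{-\epsilon}X'$ for every $\epsilon>0$. Then there are a subfamily $\mathbb V'\subset\mathbb V$, a shading $Y'$ of $\mathbb V'$ with $Y'(V)\subset Y(V)$ for all $V\in\mathbb V'$, and a subfamily $\mathbb W'\subset\mathbb W$ such that $\mathbb V'=\bigsqcup_{W\in\mathbb W'}\mathbb V'_W$ with $\mathbb V'_W=\mathbb V_W\cap\mathbb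 V'$, and there are measurable sets $$Y_{\mathbb W'}(W)\subset N_{w_1}\bigl(U(\mathbb V'_W,Y')\bigr)\subset N_{w_1}(W)\qquad(W\in\mathbb W')$$ with the following properties. (Here $Y_{\mathbb W'}$ is regarded as a shading of the family of the neighbourhoods $N_{w_1}(W)$, so that $\lambda(\mathbb W',Y_{\mathbb W'})=\sum_{\mathbb W'}|Y_{\mathbb W'}(W)|\big/\sum_{\mathbb W'}|N_{w_1}(W)|$.) 1. $\sum_{\mathbb V}|Y(V)|\lessapprox\sum_{\mathbb V'}|Y'(V)|$. 2. $C^{-1}\lambda(\mathbb V,Y)^2\lessapprox\lambda(\mathbb W',Y_{\mathbb W'})$. 3. For some integer $m$, $m\le|\mathbb W'_{Y_{\mathbb W'}}(x)|\le K_0m$ for all $x\in U(\mathbb W',Y_{\mathbb W'})$. 4. For some integer $m'$, $m'\le|(\mathbb V'_W)_{Y'}(x)|\le K_0m'$ for all $W\in\mathbb W'$ and all $x\in U(\mathbb V'_W,Y')$. 5. $\mu(\mathbb V,Y)\lessapprox\mu(\mathbb W',Y_{\mathbb W'})\,\mu(\mathbb V'_W,Y')$ for all $W\in\mathbb W'$.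 6. For every $x\in U(\mathbb V',Y')$, $$\mathbb V'_{Y'}(x)\subset\bigcup_{W\in\mathbb W',\;x\in Y_{\mathbb W'}(W)}(\mathbb V'_W)_{Y'}(x).$$ 7. $|U(\mathbb V',Y')\cap B(x,w_1)|\le K_0\,|U(\mathbb V',Y')\cap B(y,w_1)|$ for all $x,y\in U(\mathbb W',Y_{\mathbb W'})$. -/

import Mathlib

open MeasureTheory
open scoped ENNReal NNReal

noncomputable section

/-- Euclidean three-space. -/
abbrev E3 : Type := EuclideanSpace ℝ (Fin 3)

/-- The solid ellipsoid with centre `c`, principal directions `b 0, b 1, b 2` (an orthonormal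
basis) and semi-axes `a 0, a 1, a 2`. -/
def ellipsoid (c : E3) (b : OrthonormalBasis (Fin 3) ℝ E3) (a : Fin 3 → ℝ) : Set E3 :=
  {x | ∑ k, (inner ℝ (b k) (x - c) / a k) ^ 2 ≤ 1}

/-- `d 0 ≤ d 1 ≤ d 2` are the dimensions of `V`: the lengths of the axes (twice the semi-axes),
in increasing order, of the outer John ellipsoid of `V`, i.e. of the ellipsoid of least volume
that contains `V`.  Only bounded sets that lie in no plane have dimensions in this sense. -/
def HasDimensions (V : Set E3) (d : Fin 3 → ℝ) : Prop :=
  (∀ k, 0 < d k) ∧ Monotone d ∧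
    ∃ (c : E3) (b : OrthonormalBasis (Fin 3) ℝ E3),
      V ⊆ ellipsoid c b (fun k => d k / 2) ∧
      ∀ (c' : E3) (b' : OrthonormalBasis (Fin 3) ℝ E3) (a' : Fin 3 → ℝ),
        (∀ k, 0 < a' k) → V ⊆ ellipsoid c' b' a' →
          volume (ellipsoid c b (fun k => d k / 2)) ≤ volume (ellipsoid c' b' a')

/-- The dimensions `d` agree with `v` up to the factor `A`. -/
def ApproxDimensions (A : ℝ) (v d : Fin 3 → ℝ) : Prop :=
  ∀ k, v k / A ≤ d k ∧ d k ≤ A * v k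

section Families

/-! A finite family of sets is an indexed family `V : ι → Set E3` restricted to a finset `S` of
indices; so subfamilies are sub-finsets. -/

variable {ι κ : Type*}

/-- `Y` is a shading of the family `(V i)`, `i ∈ S`: each `Y i` is a Lebesgue measurable subset
of `V i`. -/
def IsShading (S : Finset ι) (V Y : ι → Set E3) : Prop :=
  ∀ i ∈ S, NullMeasurableSet (Y i) volume ∧ Y i ⊆ V i

/-- `U(𝕍, Y)`: the union of the shadings. -/
def shadedUnion (S : Finset ι) (Y : ι → Set E3) : Set E3 := ⋃ i ∈ S, Y i

/-- `∑ |Y(V)|`, the total mass of the shading. -/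
def mass (S : Finset ι) (Y : ι → Set E3) : ℝ≥0∞ := ∑ i ∈ S, volume (Y i)

/-- `λ(𝕍, Y) = ∑ |Y(V)| / ∑ |V|`. -/
def shadingDensity (S : Finset ι) (V Y : ι → Set E3) : ℝ≥0∞ := mass S Y / mass S V

/-- `μ(𝕍, Y) = ∑ |Y(V)| / |U(𝕍, Y)|`. -/
def avgMultiplicity (S : Finset ι) (Y : ι → Set E3) : ℝ≥0∞ :=
  mass S Y / volume (shadedUnion S Y)

/-- `𝕍_Y(x)`: the (indices of the) members of the family whose shading contains `x`. -/
def incident (S : Finset ι) (Y : ι → Set E3) (x : E3) : Set ι := {i | i ∈ S ∧ x ∈ Y i}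

/-- `μ(𝕍, Y)(x)`, the number of members of the family whose shading contains `x`. -/
def multiplicityAt (S : Finset ι) (Y : ι → Set E3) (x : E3) : ℕ := (incident S Y x).ncard

/-- At every point of `U(𝕍, Y)` the multiplicity is `m`, up to the factor `K`. -/
def HasConstantMultiplicity (K m : ℕ) (S : Finset ι) (Y : ι → Set E3) : Prop :=
  ∀ x ∈ shadedUnion S Y, m ≤ multiplicityAt S Y x ∧ multiplicityAt S Y x ≤ K * m

/-- `(𝕍', Y')` is a refinement of `(𝕍, Y)`. -/
def IsRefinement (S' : Finset ι) (Y' : ι → Set E3) (S : Finset ι) (Y : ι → Set E3) : Prop :=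
  S' ⊆ S ∧ ∀ i ∈ S', Y' i ⊆ Y i

open Classical in
/-- `Δ(𝕍, K)`: the total volume of the members contained in `K`, divided by `|K|`. -/
def setDensity (S : Finset ι) (V : ι → Set E3) (K : Set E3) : ℝ≥0∞ :=
  (∑ i ∈ S.filter (fun i => V i ⊆ K), volume (V i)) / volume K

/-- `C_F(𝕍, K)`: the supremum of `Δ(𝕍, K')` over all convex `K' ⊆ K`, divided by `Δ(𝕍, K)`. -/
def frostmanConstant (S : Finset ι) (V : ι → Set E3) (K : Set E3) : ℝ≥0∞ :=
  (⨆ (K' : Set E3) (_ : Convex ℝ K' ∧ K' ⊆ K), setDensity S V K') / setDensity S V K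

open Classical in
/-- `𝕍_W` (for the index `j` of `W`) when the partition is given by `p`, which assigns to each
member of `𝕍` its parent in `𝕎`. -/
def part (S : Finset ι) (p : ι → κ) (j : κ) : Finset ι := S.filter (fun i => p i = j)

end Families

/-- `X ⪅ Y` at scale `ρ`: for every `ε > 0`, `X ≤ K(ε) ρ^{-ε} Y`. -/
def LessApprox (K : ℝ → ℝ) (ρ : ℝ) (X Y : ℝ≥0∞) : Prop :=
  ∀ ε : ℝ, 0 < ε → X ≤ ENNReal.ofReal (K ε * ρ ^ (-ε)) * Y

end

/-!
Write `r = w₁`, and let `n` be the number of members of `𝕍`, so that `n ≤ 1 / ρ`.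

**Geometry of the dimensions.** By the easy half of John's theorem, with a poor constant, a convex
set contains the copy of its outer John ellipsoid shrunk by the factor `10`
(`shrunk_ellipsoid_subset_closure`). Hence, up to constants that depend on `A`, all members of `𝕍`
have the same volume, as do all members of `𝕎` and their `r`-neighbourhoods; each `W` lies in a slab
of width about `r`; and, since `V ⊆ W` forces `v₁ ≲ r`, the diameters of the members of `𝕍` are
`≲ r / ρ`.

**Refinement.** Fix a grid of cubes of side `r / 2`, whose diameters are less than `r`. Dyadic
pigeonholing of the number of members of `𝕍_W` and of the multiplicity of `Y` within `𝕍_W`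
(`exists_uniform_parts`), followed by that of the cubes `Q` according to the number of `W` whose
shaded union meets `Q` and to the volume of `U ∩ Q` (`exists_uniform_cubes`), costs a power of
`log (1 / ρ)`: there are at most `(A / ρ) ^ O(1)` cubes, so the cubes where `U` has tiny volume can be
discarded. The selections only ever restrict all shadings within one `𝕍_W` to a common set, so the
multiplicity within the parts is not disturbed by later steps; likewise the two quantities attached
to a cube are not changed when other cubes are removed. The shading of `W` is the union of the
selected cubes that its part meets. Pointwise containment and constant multiplicity of this
shading are then immediate, a ball of radius `r` contains one cube and meets at most `125`, and the
estimate for the average multiplicities is a count.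

**Density.** The one analytic point is that the shading of `W` cannot be small. By Cauchy–Schwarz
over the cubes, the square of the mass of `Y'` in `𝕍_W` is at most the number of cubes times
`∑ |{(x, y) ∈ V × V' : |x - y| < r}|` over pairs `V, V'` in `𝕍_W` (`mass_sq_le`). A pair contributes
at most `64 |V| |V'| / N` if the convex set `V - V'` contains `N` points that are `r`-separated up to
a constant (`card_mul_volume_closePairs_le`). If `V'` is no longer than `V` and reaches to distance
`h` from the long axis of `V`, then `V - V'` contains a triangle with base about `diam V` and
height about `h`, whence `N ≳ diam V * h / r ^ 2` (`mul_volume_closePairs_le`), while all such `V'`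
lie in the convex set `{x ∈ W : dist (x, axis) ≤ h, |x - p| ≲ diam V}`, whose volume is
`≲ r * h * diam V` because `W` lies in a slab of width `r`. So the Frostman condition bounds the
contribution of each dyadic range of `h` by the same quantity
(`sum_volume_closePairs_le_of_diam_le`), and there are `≲ log (1 / ρ)` ranges. A second use of
Cauchy–Schwarz passes from the individual `W` to the averages (`inv_mul_sq_le_of_forall`).
-/

/-! ### Outer John ellipsoids -/

/-- The linear map that carries an ellipsoid with principal directions `b` and semi-axes `a`,
centred at the origin, to the unit ball: it divides the `k`-th coordinate by `a k`. -/
noncomputable def axisScaling (b : OrthonormalBasis (Fin 3) ℝ E3) (a : Fin 3 → ℝ) : E3 →ₗ[ℝ] E3 :=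
  ∑ k, (a k)⁻¹ • ((innerₛₗ ℝ (b k)).smulRight (b k))

lemma axisScaling_apply (b : OrthonormalBasis (Fin 3) ℝ E3) (a : Fin 3 → ℝ) (x : E3) :
    axisScaling b a x = ∑ k, (inner ℝ (b k) x / a k) • b k := by
  simp only [axisScaling, LinearMap.sum_apply, LinearMap.smul_apply, LinearMap.smulRight_apply,
    innerₛₗ_apply_apply, smul_smul, div_eq_inv_mul]

lemma norm_sq_axisScaling (b : OrthonormalBasis (Fin 3) ℝ E3) (a : Fin 3 → ℝ) (x : E3) :
    ‖axisScaling b a x‖ ^ 2 = ∑ k, (inner ℝ (b k) x / a k) ^ 2 := by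
  rw [axisScaling_apply, ← b.sum_sq_norm_inner_right]
  refine Finset.sum_congr rfl fun k _ => ?_
  rw [b.orthonormal.inner_right_fintype, Real.norm_eq_abs, sq_abs]

lemma mem_ellipsoid_iff (c : E3) (b : OrthonormalBasis (Fin 3) ℝ E3) (a : Fin 3 → ℝ) (x : E3) :
    x ∈ ellipsoid c b a ↔ ‖axisScaling b a (x - c)‖ ≤ 1 := by
  rw [ellipsoid, Set.mem_ofPred_eq, ← norm_sq_axisScaling, sq_le_one_iff₀ (norm_nonneg _)]

lemma det_axisScaling (b : OrthonormalBasis (Fin 3) ℝ E3) (a : Fin 3 → ℝ) :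
    LinearMap.det (axisScaling b a) = ∏ k, (a k)⁻¹ := by
  rw [← LinearMap.det_toMatrix b.toBasis]
  have : LinearMap.toMatrix b.toBasis b.toBasis (axisScaling b a)
      = Matrix.diagonal fun k => (a k)⁻¹ := by
    ext i j
    rw [LinearMap.toMatrix_apply]
    simp only [OrthonormalBasis.coe_toBasis, OrthonormalBasis.coe_toBasis_repr_apply,
      OrthonormalBasis.repr_apply_apply]
    rw [axisScaling_apply, b.orthonormal.inner_right_fintype, Matrix.diagonal_apply,
      b.inner_eq_ite]
    by_cases h : i = j <;> simp [h]
  rw [this, Matrix.det_diagonal]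

lemma volume_preimage_ball (T : E3 →ₗ[ℝ] E3) (hT : LinearMap.det T ≠ 0) (c : E3) (S : Set E3) :
    volume {x : E3 | T (x - c) ∈ S} = ENNReal.ofReal |(LinearMap.det T)⁻¹| * volume S := by
  rw [← Measure.addHaar_preimage_linearMap volume hT]
  have h := measure_preimage_add_right volume (-c) (T ⁻¹' S)
  simp only [← sub_eq_add_neg] at h
  exact h

lemma volume_scaled_ball {b : OrthonormalBasis (Fin 3) ℝ E3} {a : Fin 3 → ℝ} (ha : ∀ k, 0 < a k)
    (c : E3) {s : ℝ} (hs : 0 ≤ s) :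
    volume {x : E3 | ‖axisScaling b a (x - c)‖ ≤ s}
      = ENNReal.ofReal (s ^ 3 * ∏ k, a k) * volume (Metric.ball (0 : E3) 1) := by
  have hd : LinearMap.det (axisScaling b a) ≠ 0 := by
    rw [det_axisScaling]
    exact Finset.prod_ne_zero_iff.2 fun k _ => inv_ne_zero (ha k).ne'
  have := volume_preimage_ball _ hd c (Metric.closedBall 0 s)
  simp only [mem_closedBall_zero_iff] at this
  rw [this, Measure.addHaar_closedBall _ _ hs, det_axisScaling, Finset.prod_inv_distrib, inv_inv,
    abs_of_nonneg (Finset.prod_nonneg fun k _ => (ha k).le), ← mul_assoc,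
    ← ENNReal.ofReal_mul (Finset.prod_nonneg fun k _ => (ha k).le)]
  simp [mul_comm]

lemma volume_scaled_open_ball {b : OrthonormalBasis (Fin 3) ℝ E3} {a : Fin 3 → ℝ}
    (ha : ∀ k, 0 < a k) (c : E3) {s : ℝ} (hs : 0 ≤ s) :
    volume {x : E3 | ‖axisScaling b a (x - c)‖ < s}
      = ENNReal.ofReal (s ^ 3 * ∏ k, a k) * volume (Metric.ball (0 : E3) 1) := by
  have hd : LinearMap.det (axisScaling b a) ≠ 0 := by
    rw [det_axisScaling]
    exact Finset.prod_ne_zero_iff.2 fun k _ => inv_ne_zero (ha k).ne'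
  have := volume_preimage_ball _ hd c (Metric.ball 0 s)
  simp only [mem_ball_zero_iff] at this
  rw [this, Measure.addHaar_ball _ _ hs, det_axisScaling, Finset.prod_inv_distrib, inv_inv,
    abs_of_nonneg (Finset.prod_nonneg fun k _ => (ha k).le), ← mul_assoc,
    ← ENNReal.ofReal_mul (Finset.prod_nonneg fun k _ => (ha k).le)]
  simp [mul_comm]

lemma volume_ellipsoid {b : OrthonormalBasis (Fin 3) ℝ E3} {a : Fin 3 → ℝ} (ha : ∀ k, 0 < a k)
    (c : E3) : volume (ellipsoid c b a)
      = ENNReal.ofReal (∏ k, a k) * volume (Metric.ball (0 : E3) 1) := by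
  have : ellipsoid c b a = {x : E3 | ‖axisScaling b a (x - c)‖ ≤ 1} := by
    ext x; exact mem_ellipsoid_iff c b a x
  rw [this, volume_scaled_ball ha c zero_le_one]; simp

/-- The preimage of the unit ball under an invertible linear map is an ellipsoid: its principal
directions are the eigenvectors of `T† T`. -/
lemma exists_ellipsoid_eq (T : E3 →ₗ[ℝ] E3) (hT : LinearMap.det T ≠ 0) (c : E3) :
    ∃ (b : OrthonormalBasis (Fin 3) ℝ E3) (a : Fin 3 → ℝ), (∀ k, 0 < a k) ∧
      ellipsoid c b a = {x | ‖T (x - c)‖ ≤ 1} := by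
  have hsym : (T.adjoint ∘ₗ T).IsSymmetric := LinearMap.isSymmetric_adjoint_mul_self T
  have hn : Module.finrank ℝ E3 = 3 := by simp [E3]
  set b := hsym.eigenvectorBasis hn with hb
  set e := hsym.eigenvalues hn with he
  have hinj : Function.Injective T :=
    (LinearMap.equivOfDetNeZero T hT).injective
  have hev : ∀ k, e k = ‖T (b k)‖ ^ 2 := by
    intro k
    have h1 : inner ℝ ((T.adjoint ∘ₗ T) (b k)) (b k) = e k := by
      rw [hb, hsym.apply_eigenvectorBasis hn k, inner_smul_left]
      simp [he]
    rw [← h1, LinearMap.comp_apply, LinearMap.adjoint_inner_left, real_inner_self_eq_norm_sq]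
  have hpos : ∀ k, 0 < e k := by
    intro k
    rw [hev]
    have : T (b k) ≠ 0 := fun h => b.orthonormal.ne_zero k (hinj (by rw [h, map_zero]))
    positivity
  refine ⟨b, fun k => (Real.sqrt (e k))⁻¹, fun k => inv_pos.2 (Real.sqrt_pos.2 (hpos k)), ?_⟩
  ext x
  set y := x - c with hy
  have h2 : ‖T y‖ ^ 2 = ∑ k, e k * (inner ℝ (b k) y) ^ 2 := by
    rw [← real_inner_self_eq_norm_sq, ← LinearMap.adjoint_inner_left, ← LinearMap.comp_apply,
      ← b.sum_inner_mul_inner]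
    refine Finset.sum_congr rfl fun k _ => ?_
    rw [hsym, hb, hsym.apply_eigenvectorBasis hn k, inner_smul_right, real_inner_comm]
    simp only [he, RCLike.ofReal_real_eq_id, id_eq, real_inner_comm]
    ring
  simp only [ellipsoid, Set.mem_ofPred_eq, ← hy]
  rw [← sq_le_one_iff₀ (norm_nonneg (T y)), h2]
  have : ∀ k, (inner ℝ (b k) y / (Real.sqrt (e k))⁻¹) ^ 2 = e k * (inner ℝ (b k) y) ^ 2 := by
    intro k
    rw [div_inv_eq_mul, mul_pow, Real.sq_sqrt (hpos k).le, mul_comm]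
  simp only [this]

/-- In the coordinates `y` in which the least-volume ellipsoid of `V` is the unit ball, `V` has a
point in every cap `⟨ν, y⟩ > 1 / 10`: the rest of the ball lies in an ellipsoid of smaller volume. -/
lemma exists_mem_cap {V : Set E3} {c : E3} {b : OrthonormalBasis (Fin 3) ℝ E3} {a : Fin 3 → ℝ}
    (ha : ∀ k, 0 < a k) (hV : V ⊆ ellipsoid c b a)
    (hmin : ∀ (c' : E3) (b' : OrthonormalBasis (Fin 3) ℝ E3) (a' : Fin 3 → ℝ),
        (∀ k, 0 < a' k) → V ⊆ ellipsoid c' b' a' →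
          volume (ellipsoid c b a) ≤ volume (ellipsoid c' b' a'))
    (ν : E3) (hν : ‖ν‖ = 1) : ∃ x ∈ V, 1 / 10 < inner ℝ ν (axisScaling b a (x - c)) := by
  by_contra! hcon
  set D := axisScaling b a with hD
  have hdD : LinearMap.det D = ∏ k, (a k)⁻¹ := det_axisScaling b a
  have hdD0 : 0 < LinearMap.det D := by
    rw [hdD]; exact Finset.prod_pos fun k _ => inv_pos.2 (ha k)
  -- an orthonormal basis whose vector `0` is `ν`
  obtain ⟨b₁, hb₁⟩ := Orthonormal.exists_orthonormalBasis_extension_of_card_eq (𝕜 := ℝ) (E := E3)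
    (ι := Fin 3) (by simp [E3]) (v := fun _ => ν) (s := {0}) (by
      constructor
      · intro i; simpa using hν
      · intro i j hij; exact absurd (Subsingleton.elim i j) hij)
  have hb0 : b₁ 0 = ν := hb₁ 0 rfl
  -- the cap lies in the ellipsoid with centre `-ν/5` and semi-axes `4/5, 11/10, 11/10`,
  -- whose volume is `0.968` times that of the ball
  set s : Fin 3 → ℝ := ![4 / 5, 11 / 10, 11 / 10] with hs
  have hspos : ∀ k, 0 < s k := by intro k; fin_cases k <;> norm_num [hs]
  set M := axisScaling b₁ s with hM
  have hdM : LinearMap.det M = ∏ k, (s k)⁻¹ := det_axisScaling b₁ s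
  have hdM' : LinearMap.det M = 125 / 121 := by
    rw [hdM, Fin.prod_univ_three]; simp only [hs, Matrix.cons_val]; norm_num
  have hdet : LinearMap.det (M ∘ₗ D) = 125 / 121 * LinearMap.det D := by
    rw [LinearMap.det_comp, hdM']
  have hdet0 : LinearMap.det (M ∘ₗ D) ≠ 0 := by rw [hdet]; positivity
  obtain ⟨z, hz⟩ := (LinearMap.equivOfDetNeZero D hdD0.ne').surjective ((1 / 5 : ℝ) • ν)
  have hz : D z = (1 / 5 : ℝ) • ν := hz
  obtain ⟨b', a', ha', hE⟩ := exists_ellipsoid_eq (M ∘ₗ D) hdet0 (c - z)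
  have hsub : V ⊆ ellipsoid (c - z) b' a' := by
    intro x hx
    have h1 := hcon x hx
    have h2 := (mem_ellipsoid_iff c b a x).1 (hV hx)
    rw [← hD] at h2
    rw [hE, Set.mem_ofPred_eq, LinearMap.comp_apply]
    have h3 : D (x - (c - z)) = D (x - c) + (1 / 5 : ℝ) • ν := by
      rw [← hz, ← map_add]; congr 1; abel
    rw [h3]
    set y := D (x - c) with hy
    rw [← sq_le_one_iff₀ (norm_nonneg _), hM, norm_sq_axisScaling, Fin.sum_univ_three]
    have h4 : ‖y‖ ^ 2 = ∑ k, (inner ℝ (b₁ k) y) ^ 2 := by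
      rw [← b₁.sum_sq_norm_inner_right]; simp
    rw [Fin.sum_univ_three, hb0] at h4
    have o1 : inner ℝ (b₁ 1) ν = 0 := by rw [← hb0, b₁.inner_eq_ite]; simp
    have o2 : inner ℝ (b₁ 2) ν = 0 := by rw [← hb0, b₁.inner_eq_ite]; simp
    have o0 : inner ℝ ν ν = (1 : ℝ) := by rw [real_inner_self_eq_norm_sq, hν]; norm_num
    rw [hb0]
    simp only [inner_add_right, inner_smul_right, o1, o2, o0]
    have h5 : ‖y‖ ^ 2 ≤ 1 := by rw [sq_le_one_iff₀ (norm_nonneg _)]; exact h2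
    have h6 : -1 ≤ inner ℝ ν y := by
      have := abs_real_inner_le_norm ν y
      rw [hν] at this
      have := abs_le.1 this
      linarith [this.1]
    simp only [hs, Matrix.cons_val_zero, Matrix.cons_val_one, Matrix.cons_val]
    nlinarith [mul_nonneg (sub_nonneg.2 h1) (by linarith : 0 ≤ inner ℝ ν y + 1)]
  have hle := hmin (c - z) b' a' ha' hsub
  have hv : volume (ellipsoid (c - z) b' a')
      = ENNReal.ofReal |(LinearMap.det (M ∘ₗ D))⁻¹| * volume (Metric.closedBall (0 : E3) 1) := by
    rw [hE, ← volume_preimage_ball _ hdet0 (c - z)]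
    simp
  rw [hv, volume_ellipsoid ha, hdet, Measure.addHaar_closedBall _ _ zero_le_one] at hle
  simp only [one_pow, ENNReal.ofReal_one, one_mul] at hle
  rw [ENNReal.mul_le_mul_iff_left (Metric.measure_ball_pos _ _ one_pos).ne' measure_ball_lt_top.ne,
    ENNReal.ofReal_le_ofReal_iff (abs_nonneg _), abs_of_pos (by positivity), mul_inv, hdD,
    Finset.prod_inv_distrib, inv_inv] at hle
  have : 0 < ∏ k, a k := Finset.prod_pos fun k _ => ha k
  linarith

/-- John's theorem with a cheap constant: a convex set contains, up to its boundary, the copy of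
its outer John ellipsoid shrunk by the factor `10`. -/
lemma shrunk_ellipsoid_subset_closure {V : Set E3} (hconv : Convex ℝ V) {c : E3}
    {b : OrthonormalBasis (Fin 3) ℝ E3} {a : Fin 3 → ℝ}
    (ha : ∀ k, 0 < a k) (hV : V ⊆ ellipsoid c b a)
    (hmin : ∀ (c' : E3) (b' : OrthonormalBasis (Fin 3) ℝ E3) (a' : Fin 3 → ℝ),
        (∀ k, 0 < a' k) → V ⊆ ellipsoid c' b' a' →
          volume (ellipsoid c b a) ≤ volume (ellipsoid c' b' a')) :
    {x : E3 | ‖axisScaling b a (x - c)‖ < 1 / 10} ⊆ closure V := by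
  intro x hx
  by_contra hxV
  obtain ⟨f, u, hf1, hf2⟩ := geometric_hahn_banach_closed_point hconv.closure isClosed_closure hxV
  set D := axisScaling b a with hD
  have hdD0 : LinearMap.det D ≠ 0 := by
    rw [hD, det_axisScaling]; exact Finset.prod_ne_zero_iff.2 fun k _ => inv_ne_zero (ha k).ne'
  set De := LinearMap.equivOfDetNeZero D hdD0 with hDe
  set g : E3 →L[ℝ] ℝ := LinearMap.toContinuousLinearMap (f.toLinearMap ∘ₗ De.symm.toLinearMap)
    with hg
  have hgD : ∀ y, g (D y) = f y := by
    intro y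
    have : De.symm (D y) = y := De.symm_apply_apply y
    simp [hg, this]
  set η := (InnerProductSpace.toDual ℝ E3).symm g with hη
  have hηg : ∀ y, inner ℝ η y = g y := fun y => InnerProductSpace.toDual_symm_apply
  obtain ⟨ν0, hν0⟩ : ∃ ν0 : E3, ‖ν0‖ = 1 := exists_norm_eq E3 zero_le_one
  obtain ⟨x0, hx0, -⟩ := exists_mem_cap ha hV hmin ν0 hν0
  have hη0 : η ≠ 0 := by
    intro h0
    have h1 := hf1 x0 (subset_closure hx0)
    have h2 : ∀ y, f y = 0 := by intro y; rw [← hgD, ← hηg, h0, inner_zero_left]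
    rw [h2] at h1 hf2
    linarith
  have hηn : 0 < ‖η‖ := norm_pos_iff.2 hη0
  obtain ⟨x1, hx1, h1⟩ := exists_mem_cap ha hV hmin ((‖η‖⁻¹ : ℝ) • η) (by
    rw [norm_smul, norm_inv, norm_norm, inv_mul_cancel₀ hηn.ne'])
  rw [inner_smul_left, ← hD, hηg, hgD] at h1
  simp only [conj_trivial] at h1
  have h2 : f (x - c) ≤ ‖η‖ * (1 / 10) := by
    rw [← hgD, ← hηg]
    refine (real_inner_le_norm _ _).trans ?_
    exact mul_le_mul_of_nonneg_left (le_of_lt hx) hηn.le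
  have h3 : f (x1 - c) < f (x - c) := by
    rw [map_sub, map_sub]
    linarith [hf1 x1 (subset_closure hx1)]
  have h4 : ‖η‖ * (1 / 10) < f (x1 - c) := by
    have := mul_lt_mul_of_pos_left h1 hηn
    rwa [← mul_assoc, mul_inv_cancel₀ hηn.ne', one_mul] at this
  linarith

section Dimensions

variable {V : Set E3} {d : Fin 3 → ℝ}

lemma abs_inner_div_le_norm_axisScaling (b : OrthonormalBasis (Fin 3) ℝ E3) (a : Fin 3 → ℝ)
    (x : E3) (k : Fin 3) : |inner ℝ (b k) x / a k| ≤ ‖axisScaling b a x‖ := by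
  rw [← sq_le_sq₀ (abs_nonneg _) (norm_nonneg _), norm_sq_axisScaling, sq_abs]
  exact Finset.single_le_sum (f := fun k => (inner ℝ (b k) x / a k) ^ 2)
    (fun k _ => sq_nonneg _) (Finset.mem_univ k)

lemma norm_axisScaling_le {b : OrthonormalBasis (Fin 3) ℝ E3} {a : Fin 3 → ℝ} {t : ℝ}
    (ht : 0 < t) (ha : ∀ k, t ≤ a k) (x : E3) : ‖axisScaling b a x‖ ≤ ‖x‖ / t := by
  rw [← sq_le_sq₀ (norm_nonneg _) (by positivity), norm_sq_axisScaling, div_pow,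
    ← b.sum_sq_norm_inner_right, Finset.sum_div]
  refine Finset.sum_le_sum fun k _ => ?_
  rw [div_pow, Real.norm_eq_abs, sq_abs]
  gcongr
  exact ha k

lemma norm_le_norm_axisScaling {b : OrthonormalBasis (Fin 3) ℝ E3} {a : Fin 3 → ℝ} {t : ℝ}
    (ha0 : ∀ k, 0 < a k) (ha : ∀ k, a k ≤ t) (x : E3) : ‖x‖ ≤ t * ‖axisScaling b a x‖ := by
  have ht : 0 < t := (ha0 0).trans_le (ha 0)
  rw [← sq_le_sq₀ (norm_nonneg _) (by positivity), mul_pow, norm_sq_axisScaling,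
    ← b.sum_sq_norm_inner_right, Finset.mul_sum]
  refine Finset.sum_le_sum fun k _ => ?_
  rw [div_pow, Real.norm_eq_abs, sq_abs, ← mul_div_assoc, le_div_iff₀ (pow_pos (ha0 k) 2), mul_comm]
  gcongr
  · exact (ha0 k).le
  · exact ha k

lemma HasDimensions.volume_le (h : HasDimensions V d) :
    volume V ≤ ENNReal.ofReal (∏ k, d k / 2) * volume (Metric.ball (0 : E3) 1) := by
  obtain ⟨hd, -, c, b, hV, -⟩ := h
  rw [← volume_ellipsoid (fun k => half_pos (hd k)) c]
  exact measure_mono hV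

lemma HasDimensions.le_volume (h : HasDimensions V d) (hconv : Convex ℝ V) :
    ENNReal.ofReal ((1 / 10) ^ 3 * ∏ k, d k / 2) * volume (Metric.ball (0 : E3) 1)
      ≤ volume V := by
  obtain ⟨hd, -, c, b, hV, hmin⟩ := h
  have hd' := fun k => half_pos (hd k)
  rw [← volume_scaled_open_ball (b := b) hd' c (by norm_num : (0 : ℝ) ≤ 1 / 10)]
  refine (measure_mono (shrunk_ellipsoid_subset_closure hconv hd' hV hmin)).trans ?_
  have hfr := hconv.addHaar_frontier (volume : Measure E3)
  rw [closure_eq_self_union_frontier]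
  refine (measure_union_le _ _).trans ?_
  rw [hfr, add_zero]

/-- A set with dimensions `d` lies in a slab of width `d 0`. -/
lemma HasDimensions.exists_slab (h : HasDimensions V d) :
    ∃ n : E3, ‖n‖ = 1 ∧ ∀ x ∈ V, ∀ y ∈ V, |inner ℝ n (x - y)| ≤ d 0 := by
  obtain ⟨hd, -, c, b, hV, -⟩ := h
  have key : ∀ x ∈ V, |inner ℝ (b 0) (x - c)| ≤ d 0 / 2 := by
    intro x hx
    have h1 := (abs_inner_div_le_norm_axisScaling b (fun k => d k / 2) (x - c) 0).trans
      ((mem_ellipsoid_iff c b _ x).1 (hV hx))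
    rwa [abs_div, abs_of_pos (half_pos (hd 0)), div_le_one (half_pos (hd 0))] at h1
  refine ⟨b 0, b.orthonormal.1 0, fun x hx y hy => ?_⟩
  have : x - y = (x - c) - (y - c) := by abel
  rw [this, inner_sub_right]
  have h1 := abs_le.1 (key x hx)
  have h2 := abs_le.1 (key y hy)
  rw [abs_le]; constructor <;> linarith [h1.1, h1.2, h2.1, h2.2]

lemma HasDimensions.dist_le (h : HasDimensions V d) {x y : E3} (hx : x ∈ V) (hy : y ∈ V) :
    dist x y ≤ d 2 := by
  obtain ⟨hd, hmono, c, b, hV, -⟩ := h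
  have key : ∀ x ∈ V, ‖x - c‖ ≤ d 2 / 2 := by
    intro x hx
    have h1 := (mem_ellipsoid_iff c b _ x).1 (hV hx)
    have h2 := norm_le_norm_axisScaling (b := b) (t := d 2 / 2) (fun k => half_pos (hd k))
      (fun k => by have := hmono (Fin.le_last k); simp only [Fin.last] at this; gcongr; exact this)
      (x - c)
    nlinarith [hd 2]
  rw [dist_eq_norm]
  have : x - y = (x - c) - (y - c) := by abel
  rw [this]
  linarith [norm_sub_le (x - c) (y - c), key x hx, key y hy]

/-- A convex set is not contained in a slab much thinner than its least dimension. -/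
lemma HasDimensions.le_of_slab (h : HasDimensions V d) (hconv : Convex ℝ V) {n : E3}
    (hn : ‖n‖ = 1) {s : ℝ} (hs : ∀ x ∈ V, ∀ y ∈ V, |inner ℝ n (x - y)| ≤ s) : d 0 ≤ 10 * s := by
  obtain ⟨hd, hmono, c, b, hV, hmin⟩ := h
  have hd' := fun k => half_pos (hd k)
  have hsub := shrunk_ellipsoid_subset_closure hconv hd' hV hmin
  have hcl : ∀ x ∈ closure V, ∀ y ∈ closure V, |inner ℝ n (x - y)| ≤ s := by
    have hclosed : IsClosed {q : E3 × E3 | |inner ℝ n (q.1 - q.2)| ≤ s} :=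
      isClosed_le (by fun_prop) continuous_const
    have h1 : V ×ˢ V ⊆ {q : E3 × E3 | |inner ℝ n (q.1 - q.2)| ≤ s} :=
      fun q hq => hs _ hq.1 _ hq.2
    have h2 := closure_minimal h1 hclosed
    rw [closure_prod_eq] at h2
    exact fun x hx y hy => @h2 (x, y) ⟨hx, hy⟩
  have hmem : ∀ t : ℝ, |t| < d 0 / 20 → c + t • n ∈ closure V := by
    intro t ht
    apply hsub
    have h1 := norm_axisScaling_le (b := b) (a := fun k => d k / 2) (hd' 0)
      (fun k => div_le_div_of_nonneg_right (hmono (Fin.zero_le k)) zero_le_two) (t • n)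
    simp only [Set.mem_ofPred_eq, add_sub_cancel_left]
    refine h1.trans_lt ?_
    rw [norm_smul, hn, mul_one, Real.norm_eq_abs, div_lt_iff₀ (hd' 0)]
    linarith
  by_contra! hlt
  have hd0 := hd 0
  have hs0 : 0 ≤ s := (abs_nonneg _).trans
    (hcl _ (hmem 0 (by simp; linarith)) _ (hmem 0 (by simp; linarith)))
  obtain ⟨t, ht1, ht2⟩ := exists_between (show s / 2 < d 0 / 20 by linarith)
  have h3 := hcl _ (hmem t (by rw [abs_of_pos (by linarith)]; exact ht2)) _
    (hmem (-t) (by rw [abs_neg, abs_of_pos (by linarith)]; exact ht2))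
  have h4 : c + t • n - (c + (-t) • n) = (2 * t) • n := by
    rw [two_mul, add_smul, neg_smul]; abel
  rw [h4, inner_smul_right, real_inner_self_eq_norm_sq, hn, abs_of_pos (by linarith)] at h3
  linarith

lemma HasDimensions.volume_thickening_le (h : HasDimensions V d) {r : ℝ} (hr : 0 ≤ r) :
    volume (Metric.thickening r V) ≤ ENNReal.ofReal ((1 + 2 * r / d 0) ^ 3 * ∏ k, d k / 2) *
      volume (Metric.ball (0 : E3) 1) := by
  obtain ⟨hd, hmono, c, b, hV, -⟩ := h
  have hd' := fun k => half_pos (hd k)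
  have hd0 := hd 0
  rw [← volume_scaled_ball (b := b) hd' c (by positivity)]
  refine measure_mono fun x hx => ?_
  obtain ⟨y, hy, hxy⟩ := Metric.mem_thickening_iff.1 hx
  have h1 := (mem_ellipsoid_iff c b _ y).1 (hV hy)
  have h2 := norm_axisScaling_le (b := b) (a := fun k => d k / 2) (hd' 0)
      (fun k => div_le_div_of_nonneg_right (hmono (Fin.zero_le k)) zero_le_two) (x - y)
  have h3 : x - c = (y - c) + (x - y) := by abel
  change ‖_‖ ≤ _
  rw [h3, map_add]
  refine (norm_add_le _ _).trans (add_le_add h1 (h2.trans ?_))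
  rw [← dist_eq_norm, div_le_div_iff₀ (hd' 0) hd0]
  nlinarith

lemma HasDimensions.volume_lt_top (h : HasDimensions V d) : volume V < ∞ :=
  h.volume_le.trans_lt (ENNReal.mul_lt_top ENNReal.ofReal_lt_top measure_ball_lt_top)

lemma HasDimensions.volume_pos (h : HasDimensions V d) (hconv : Convex ℝ V) : 0 < volume V := by
  refine lt_of_lt_of_le ?_ (h.le_volume hconv)
  have : 0 < ∏ k, d k / 2 := Finset.prod_pos fun k _ => half_pos (h.1 k)
  exact ENNReal.mul_pos (ENNReal.ofReal_pos.2 (by positivity)).ne' (Metric.measure_ball_pos _ _ one_pos).ne'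

end Dimensions

/-! ### Close pairs of points of two convex sets -/

/-- The pairs of points of `A × B` at distance less than `r`. -/
def closePairs (r : ℝ) (A B : Set E3) : Set (E3 × E3) :=
  {q | q.1 ∈ A ∧ q.2 ∈ B ∧ dist q.1 q.2 < r}

lemma convex_closePairs (r : ℝ) {A B : Set E3} (hA : Convex ℝ A) (hB : Convex ℝ B) :
    Convex ℝ (closePairs r A B) := by
  have h1 : closePairs r A B = (A ×ˢ B) ∩ {q : E3 × E3 | dist q.1 q.2 < r} := by
    ext q; simp [closePairs, and_assoc]
  have h2 : {q : E3 × E3 | dist q.1 q.2 < r}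
      = (LinearMap.fst ℝ E3 E3 - LinearMap.snd ℝ E3 E3) ⁻¹' Metric.ball 0 r := by
    ext q; simp [dist_eq_norm]
  rw [h1, h2]
  exact (hA.prod hB).inter ((convex_ball 0 r).linear_preimage _)

lemma volume_closePairs_comm (r : ℝ) (A B : Set E3) :
    volume (closePairs r A B) = volume (closePairs r B A) := by
  have h := (Measure.measurePreserving_swap (μ := (volume : Measure E3))
    (ν := (volume : Measure E3))).measure_preimage_equiv (f := MeasurableEquiv.prodComm)
    (closePairs r B A)
  rw [Measure.volume_eq_prod, ← h]
  congr 1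
  ext q
  change q.1 ∈ A ∧ q.2 ∈ B ∧ dist q.1 q.2 < r ↔ q.2 ∈ B ∧ q.1 ∈ A ∧ dist q.2 q.1 < r
  rw [dist_comm, and_left_comm]

instance : (volume : Measure (E3 × E3)).IsAddHaarMeasure := by
  rw [Measure.volume_eq_prod]; infer_instance

lemma Convex.sum_three_mem {E : Type*} [AddCommGroup E] [Module ℝ E] {s : Set E}
    (hs : Convex ℝ s) {x y z : E} (hx : x ∈ s) (hy : y ∈ s) (hz : z ∈ s) {a b c : ℝ}
    (ha : 0 ≤ a) (hb : 0 ≤ b) (hc : 0 ≤ c) (h : a + b + c = 1) : a • x + b • y + c • z ∈ s := by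
  have := hs.sum_mem (t := Finset.univ) (w := ![a, b, c]) (z := ![x, y, z])
    (by intro i _; fin_cases i <;> simpa) (by simpa [Fin.sum_univ_three] using h)
    (by intro i _; fin_cases i <;> simpa)
  simpa [Fin.sum_univ_three] using this

/-- If the convex set `A - B` contains `N` points that are `2r`-separated, then at most a fraction
`64 / N` of the pairs in `A × B` are at distance less than `r`: the midpoints of those pairs with
the `N` pairs that realise the separated differences form `N` disjoint subsets of `A × B`. -/
lemma card_mul_volume_closePairs_le {A B : Set E3} (hA : Convex ℝ A) (hB : Convex ℝ B) {r : ℝ}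
    {α : Type*} (t : Finset α) (q : α → E3 × E3) (hq : ∀ i ∈ t, q i ∈ A ×ˢ B)
    (hsep : ∀ i ∈ t, ∀ j ∈ t, i ≠ j →
      2 * r ≤ ‖((q i).1 - (q i).2) - ((q j).1 - (q j).2)‖) :
    (t.card : ℝ≥0∞) * volume (closePairs r A B) ≤ 64 * (volume A * volume B) := by
  set S := closePairs r A B with hS
  have hSc : Convex ℝ S := convex_closePairs r hA hB
  set f : α → Set (E3 × E3) := fun i => AffineMap.homothety (q i) (1 / 2 : ℝ) '' S with hf
  have hfv : ∀ i, volume (f i) = ENNReal.ofReal (1 / 64) * volume S := by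
    intro i
    have := Measure.addHaar_image_homothety (volume : Measure (E3 × E3)) (q i) (1 / 2 : ℝ) S
    rw [hf]
    simp only
    rw [this]
    have h6 : Module.finrank ℝ (E3 × E3) = 6 := by simp [E3]
    rw [h6]; norm_num
  have hval : ∀ i (y : E3 × E3),
      AffineMap.homothety (q i) (1 / 2 : ℝ) y = (1 / 2 : ℝ) • (y - q i) + q i := by
    intro i y; simp [AffineMap.homothety_apply]
  have hdisj : Set.Pairwise (t : Set α) (Function.onFun (AEDisjoint volume) f) := by
    intro i hi j hj hij
    refine Disjoint.aedisjoint (Set.disjoint_left.2 ?_)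
    rintro _ ⟨x, hx, rfl⟩ ⟨y, hy, hxy⟩
    rw [hval, hval] at hxy
    have h1 := congrArg Prod.fst hxy
    have h2 := congrArg Prod.snd hxy
    simp only [Prod.fst_add, Prod.snd_add, Prod.smul_fst, Prod.smul_snd, Prod.fst_sub,
      Prod.snd_sub] at h1 h2
    have h3 : ((q i).1 - (q i).2) - ((q j).1 - (q j).2) = (y.1 - y.2) - (x.1 - x.2) := by
      have e1 : (q i).1 - (q j).1 = y.1 - x.1 := by
        linear_combination (norm := module) (-2 : ℝ) • h1
      have e2 : (q i).2 - (q j).2 = y.2 - x.2 := by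
        linear_combination (norm := module) (-2 : ℝ) • h2
      linear_combination (norm := module) e1 - e2
    have h4 := hsep i hi j hj hij
    rw [h3] at h4
    have hx3 : ‖x.1 - x.2‖ < r := by rw [← dist_eq_norm]; exact hx.2.2
    have hy3 : ‖y.1 - y.2‖ < r := by rw [← dist_eq_norm]; exact hy.2.2
    linarith [norm_sub_le (y.1 - y.2) (x.1 - x.2)]
  have hmeas : ∀ i ∈ t, NullMeasurableSet (f i) volume := fun i _ =>
    (hSc.affine_image _).nullMeasurableSet volume
  have hsub : (⋃ i ∈ t, f i) ⊆ A ×ˢ B := by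
    intro y hy
    simp only [Set.mem_iUnion] at hy
    obtain ⟨i, hi, x, hx, rfl⟩ := hy
    rw [hval]
    have h1 : (1 / 2 : ℝ) • (x - q i) + q i = (1 / 2 : ℝ) • x + (1 / 2 : ℝ) • q i := by
      module
    rw [h1]
    exact (hA.prod hB) (x := x) ⟨hx.1, hx.2.1⟩ (hq i hi) (by norm_num) (by norm_num) (by norm_num)
  have h1 := measure_mono (μ := volume) hsub
  rw [measure_biUnion_finset₀ hdisj hmeas, Finset.sum_congr rfl (fun i _ => hfv i),
    Finset.sum_const, nsmul_eq_mul, Measure.volume_eq_prod, Measure.prod_prod] at h1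
  calc (t.card : ℝ≥0∞) * volume S
      = 64 * (t.card * (ENNReal.ofReal (1 / 64) * volume S)) := by
        have : (64 : ℝ≥0∞) * ENNReal.ofReal (1 / 64) = 1 := by
          rw [← ENNReal.ofReal_ofNat, ← ENNReal.ofReal_mul (by norm_num)]; norm_num
        calc _ = (64 * ENNReal.ofReal (1 / 64)) * (t.card * volume S) := by rw [this, one_mul]
          _ = _ := by ring
    _ ≤ _ := by
      gcongr 64 * ?_
      exact h1

/-- The component of `x` orthogonal to `e`, for a unit vector `e`. -/
noncomputable def perp (e : E3) : E3 →ₗ[ℝ] E3 :=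
  LinearMap.id - (innerₛₗ ℝ e).smulRight e

lemma perp_apply (e x : E3) : perp e x = x - (inner ℝ e x : ℝ) • e := by
  simp [perp]

lemma norm_perp_le {e : E3} (he : ‖e‖ = 1) (x : E3) : ‖perp e x‖ ≤ ‖x‖ := by
  rw [← sq_le_sq₀ (norm_nonneg _) (norm_nonneg _), perp_apply, norm_sub_sq_real, norm_smul, he,
    inner_smul_right, real_inner_comm, mul_one, Real.norm_eq_abs, sq_abs]
  nlinarith [sq_nonneg (inner ℝ e x)]

lemma inner_perp {e f : E3} (hfe : inner ℝ f e = 0) (x : E3) :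
    inner ℝ f (perp e x) = inner ℝ f x := by
  rw [perp_apply, inner_sub_right, inner_smul_right, hfe]; simp

lemma perp_self {e : E3} (he : ‖e‖ = 1) : perp e e = 0 := by
  rw [perp_apply, real_inner_self_eq_norm_sq, he]; simp

/-- The fraction of close pairs in `V × V'`, when `V` contains a segment from `p` to `p + D e` and
`V'` has a point `z` far from the line through that segment.  If there is a close pair `(a, b)`,
then `V - V'` contains the triangle with vertices `p - z`, `p + D e - z` and `a - b ≈ 0`; a grid of
`2r`-separated points in this triangle is fed into `card_mul_volume_closePairs_le`. -/
lemma mul_volume_closePairs_le {V V' : Set E3} (hV : Convex ℝ V) (hV' : Convex ℝ V') {r D : ℝ}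
    (hr : 0 < r) (hD : 0 < D) {p e z : E3} (he : ‖e‖ = 1) (hp : p ∈ V) (hq : p + D • e ∈ V)
    (hz : z ∈ V') :
    (((⌊D / (4 * r)⌋₊ + 1) * (⌊(‖perp e (z - p)‖ - r) / (4 * r)⌋₊ + 1) : ℕ) : ℝ≥0∞) *
      volume (closePairs r V V') ≤ 64 * (volume V * volume V') := by
  rcases (closePairs r V V').eq_empty_or_nonempty with h0 | ⟨⟨a, b⟩, ha, hb, hab⟩
  · rw [h0]; simp
  simp only at ha hb hab
  set N₁ := ⌊D / (4 * r)⌋₊ + 1 with hN₁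
  set N₂ := ⌊(‖perp e (z - p)‖ - r) / (4 * r)⌋₊ + 1 with hN₂
  set w : E3 := (a - b) - (p - z) with hw
  set H := ‖perp e w‖ with hH
  have hHge : ‖perp e (z - p)‖ - r ≤ H := by
    have h1 : z - p = w - (a - b) := by rw [hw]; abel
    have h2 : ‖perp e (a - b)‖ < r := (norm_perp_le he _).trans_lt (by rwa [← dist_eq_norm])
    rw [h1, map_sub]
    linarith [norm_sub_le (perp e w) (perp e (a - b))]
  have hσ : ∀ i ∈ Finset.range N₁, 2 * r * i / D ≤ 1 / 2 := by
    intro i hi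
    have h1 : i ≤ ⌊D / (4 * r)⌋₊ := Nat.lt_succ_iff.1 (Finset.mem_range.1 hi)
    have h2 : (i : ℝ) ≤ D / (4 * r) :=
      (Nat.cast_le.2 h1).trans (Nat.floor_le (by positivity))
    rw [le_div_iff₀ (by positivity)] at h2
    rw [div_le_iff₀ hD]; linarith
  have hτ' : ∀ i ∈ Finset.range N₂, 4 * r * i ≤ H := by
    intro i hi
    have h1 : i ≤ ⌊(‖perp e (z - p)‖ - r) / (4 * r)⌋₊ := Nat.lt_succ_iff.1 (Finset.mem_range.1 hi)
    rcases Nat.eq_zero_or_pos i with h0 | h0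
    · rw [h0]; simp [hH]
    have h2 : (i : ℝ) ≤ (‖perp e (z - p)‖ - r) / (4 * r) := by
      rwa [Nat.le_floor_iff' h0.ne'] at h1
    rw [le_div_iff₀ (by positivity)] at h2
    linarith
  have hτ : ∀ i ∈ Finset.range N₂, 2 * r * i / H ≤ 1 / 2 := by
    intro i hi
    have h1 := hτ' i hi
    rcases (norm_nonneg (perp e w)).eq_or_lt with h0 | h0
    · rw [hH, ← h0]; simp
    · rw [div_le_iff₀ h0]; linarith
  have hτH : ∀ i ∈ Finset.range N₂, 2 * r * i / H * H = 2 * r * i := by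
    intro i hi
    have h1 := hτ' i hi
    rcases (norm_nonneg (perp e w)).eq_or_lt with h0 | h0
    · rw [← hH] at h0
      rw [← h0] at h1 ⊢
      have : 0 ≤ 4 * r * (i : ℝ) := by positivity
      linarith
    · exact div_mul_cancel₀ _ h0.ne'
  have hmulH : ∀ x : ℝ, |x| * H = |x * H| := fun x => by
    rw [abs_mul, abs_of_nonneg (norm_nonneg _ : 0 ≤ H)]
  have hint : ∀ i j : ℕ, i ≠ j → (1 : ℝ) ≤ |(i : ℝ) - j| := by
    intro i j hij
    have : (1 : ℤ) ≤ |(i : ℤ) - j| := Int.one_le_abs (sub_ne_zero.2 (by exact_mod_cast hij))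
    exact_mod_cast this
  set Q : ℕ × ℕ → E3 × E3 := fun ij =>
    (1 - 2 * r * ij.1 / D - 2 * r * ij.2 / H) • (p, z) + (2 * r * ij.1 / D) • (p + D • e, z)
      + (2 * r * ij.2 / H) • (a, b) with hQ
  have key := card_mul_volume_closePairs_le hV hV' (r := r) (Finset.range N₁ ×ˢ Finset.range N₂) Q
    (by
      rintro ⟨i, j⟩ hij
      obtain ⟨hi, hj⟩ := Finset.mem_product.1 hij
      have h1 := hσ i hi
      have h2 := hτ j hj
      have h3 : (0 : ℝ) ≤ 2 * r * i / D := by positivity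
      have h4 : (0 : ℝ) ≤ 2 * r * j / H := by positivity
      exact (hV.prod hV').sum_three_mem (x := (p, z)) (y := (p + D • e, z)) (z := (a, b))
        ⟨hp, hz⟩ ⟨hq, hz⟩ ⟨ha, hb⟩ (by simp only; linarith) h3 h4 (by simp only; ring))
    (by
      rintro ⟨i, j⟩ hij ⟨i', j'⟩ hij' hne
      obtain ⟨hi, hj⟩ := Finset.mem_product.1 hij
      obtain ⟨hi', hj'⟩ := Finset.mem_product.1 hij'
      simp only at hi hj hi' hj'
      have hdiff : ((Q (i, j)).1 - (Q (i, j)).2) - ((Q (i', j')).1 - (Q (i', j')).2)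
          = (2 * r * i / D * D - 2 * r * i' / D * D) • e
            + (2 * r * j / H - 2 * r * j' / H) • w := by
        simp only [hQ, hw, Prod.fst_add, Prod.snd_add, Prod.smul_fst, Prod.smul_snd]
        module
      rw [hdiff]
      by_cases hjj : j = j'
      · have hii : i ≠ i' := fun h => hne (by rw [h, hjj])
        rw [hjj, sub_self, zero_smul, add_zero, norm_smul, he, mul_one,
          div_mul_cancel₀ _ hD.ne', div_mul_cancel₀ _ hD.ne', ← mul_sub, Real.norm_eq_abs, abs_mul,
          abs_of_pos (by positivity : 0 < 2 * r)]
        nlinarith [hint i i' hii]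
      · refine le_trans ?_ (norm_perp_le he _)
        rw [map_add, map_smul, map_smul, perp_self he, smul_zero, zero_add, norm_smul, ← hH,
          Real.norm_eq_abs, hmulH, sub_mul,
          hτH j hj, hτH j' hj', ← mul_sub, abs_mul, abs_of_pos (by positivity : 0 < 2 * r)]
        nlinarith [hint j j' hjj])
  rw [Finset.card_product, Finset.card_range, Finset.card_range] at key
  exact key

/-! ### Córdoba's estimate for Frostman families -/

lemma exists_unit_orthogonal (n e : E3) :
    ∃ f : E3, ‖f‖ = 1 ∧ inner ℝ f n = 0 ∧ inner ℝ f e = 0 := by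
  set U : Submodule ℝ E3 := Submodule.span ℝ (({n, e} : Finset E3) : Set E3) with hU
  have h1 : Module.finrank ℝ U ≤ 2 := (finrank_span_finset_le_card _).trans Finset.card_le_two
  have h2 : Module.finrank ℝ U + Module.finrank ℝ Uᗮ = 3 := by
    rw [U.finrank_add_finrank_orthogonal]; simp [E3]
  have h3 : Uᗮ ≠ ⊥ := by
    intro h; rw [h, finrank_bot] at h2; omega
  obtain ⟨g, hg, hg0⟩ := Submodule.exists_mem_ne_zero_of_ne_bot h3
  have hn : inner ℝ g n = 0 := Submodule.inner_left_of_mem_orthogonal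
    (Submodule.subset_span (by simp)) hg
  have he : inner ℝ g e = 0 := Submodule.inner_left_of_mem_orthogonal
    (Submodule.subset_span (by simp)) hg
  have hgn : ‖g‖ ≠ 0 := norm_ne_zero_iff.2 hg0
  refine ⟨(‖g‖⁻¹ : ℝ) • g, ?_, ?_, ?_⟩
  · rw [norm_smul, norm_inv, norm_norm, inv_mul_cancel₀ hgn]
  · rw [inner_smul_left, hn, mul_zero]
  · rw [inner_smul_left, he, mul_zero]

lemma volume_box_le (b : OrthonormalBasis (Fin 3) ℝ E3) (p : E3) (c : Fin 3 → ℝ)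
    (hc : ∀ k, 0 ≤ c k) :
    volume {x : E3 | ∀ k, |inner ℝ (b k) (x - p)| ≤ c k} ≤ ENNReal.ofReal (8 * ∏ k, c k) := by
  set q : Fin 3 → ℝ := fun k => inner ℝ (b k) p with hq
  have h1 : {x : E3 | ∀ k, |inner ℝ (b k) (x - p)| ≤ c k}
      = b.repr ⁻¹' (WithLp.ofLp ⁻¹' (Set.Icc (q - c) (q + c))) := by
    ext x
    simp only [Set.mem_ofPred_eq, Set.mem_preimage, Set.mem_Icc, Pi.le_def, ← forall_and]
    refine forall_congr' fun k => ?_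
    rw [inner_sub_right, abs_le, b.repr_apply_apply]
    simp only [hq, Pi.sub_apply, Pi.add_apply]
    constructor <;> rintro ⟨h1, h2⟩ <;> constructor <;> linarith
  have hm : MeasurableSet (WithLp.ofLp ⁻¹' (Set.Icc (q - c) (q + c)) : Set E3) :=
    (PiLp.volume_preserving_ofLp (Fin 3)).measurable measurableSet_Icc
  rw [h1, b.measurePreserving_repr.measure_preimage hm.nullMeasurableSet,
    (PiLp.volume_preserving_ofLp (Fin 3)).measure_preimage measurableSet_Icc.nullMeasurableSet,
    Real.volume_Icc_pi, ← ENNReal.ofReal_prod_of_nonneg]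
  · apply ENNReal.ofReal_le_ofReal
    simp only [Fin.prod_univ_three, Pi.sub_apply, Pi.add_apply]
    apply le_of_eq; ring
  · intro k _; simp only [Pi.sub_apply, Pi.add_apply]; linarith [hc k]

/-- The part of a slab of half-width `α` in the intersection of a cylinder of radius `β` with a
ball of radius `γ` has volume at most `8 α β γ`, whatever the direction `e` of the cylinder:
some unit vector is orthogonal both to `e` and to the normal `n` of the slab. -/
lemma volume_slab_cylinder_le {n e : E3} (hn : ‖n‖ = 1) (p : E3) {α β γ : ℝ}
    (hα : 0 ≤ α) (hβ : 0 ≤ β) (hγ : 0 ≤ γ) {K : Set E3}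
    (h₁ : ∀ x ∈ K, |inner ℝ n (x - p)| ≤ α) (h₂ : ∀ x ∈ K, ‖perp e (x - p)‖ ≤ β)
    (h₃ : ∀ x ∈ K, ‖x - p‖ ≤ γ) : volume K ≤ ENNReal.ofReal (8 * (α * β * γ)) := by
  obtain ⟨f, hf, hfn, hfe⟩ := exists_unit_orthogonal n e
  obtain ⟨b, hb⟩ := Orthonormal.exists_orthonormalBasis_extension_of_card_eq (𝕜 := ℝ) (E := E3)
    (ι := Fin 3) (by simp [E3]) (v := ![n, f, 0]) (s := {0, 1}) (by
      rw [orthonormal_iff_ite]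
      rintro ⟨i, hi⟩ ⟨j, hj⟩
      rcases hi with rfl | rfl <;> rcases hj with rfl | rfl <;>
        simp [hn, hf, hfn, real_inner_comm f n, Subtype.ext_iff])
  have hb0 : b 0 = n := hb 0 (by simp)
  have hb1 : b 1 = f := hb 1 (by simp)
  have hsub : K ⊆ {x : E3 | ∀ k, |inner ℝ (b k) (x - p)| ≤ ![α, β, γ] k} := by
    intro x hx k
    fin_cases k
    · simpa [hb0] using h₁ x hx
    · have h4 : |inner ℝ f (x - p)| ≤ β := by
        rw [← inner_perp hfe]
        refine (abs_real_inner_le_norm _ _).trans ?_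
        rw [hf, one_mul]; exact h₂ x hx
      simpa [hb1] using h4
    · have h4 : |inner ℝ (b 2) (x - p)| ≤ γ := by
        refine (abs_real_inner_le_norm _ _).trans ?_
        rw [b.orthonormal.1 2, one_mul]; exact h₃ x hx
      simpa using h4
  refine (measure_mono hsub).trans ((volume_box_le b p _ ?_).trans ?_)
  · intro k; fin_cases k <;> simpa
  · simp [Fin.prod_univ_three]

section Cordoba

variable {ι : Type*}

open Classical in
/-- The members of a Frostman family that are no longer than a fixed member `V₀`, weighted by the
number of close pairs that they form with `V₀`.  They are sorted by their distance `2 ^ k * r` from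
the axis of `V₀`; the members of one class lie in one convex subset of `W`. -/
lemma sum_volume_closePairs_le_of_diam_le {s : Finset ι} {V : ι → Set E3} {W : Set E3} {r α R : ℝ}
    {Φ : ℝ≥0∞} {k₀ : ℕ} (hconv : ∀ i ∈ s, Convex ℝ (V i)) (hW : Convex ℝ W)
    (hsub : ∀ i ∈ s, V i ⊆ W) (hr : 0 < r) {n : E3} (hn : ‖n‖ = 1)
    (hslab : ∀ x ∈ W, ∀ y ∈ W, |inner ℝ n (x - y)| ≤ α)
    (hF : ∀ K : Set E3, Convex ℝ K → K ⊆ W → Bornology.IsBounded K →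
      ∑ i ∈ s with V i ⊆ K, volume (V i) ≤ Φ * volume K)
    (hR : ∀ i ∈ s, ∀ x ∈ V i, ∀ y ∈ V i, dist x y ≤ R) (hk₀ : 4 * R + r ≤ 2 ^ k₀ * r)
    {i₀ : ι} (hi₀ : i₀ ∈ s) (hpos : ∀ i ∈ s, volume (V i) ≠ 0) :
    ∑ i ∈ s with Metric.diam (V i) ≤ Metric.diam (V i₀), volume (closePairs r (V i₀) (V i))
      ≤ (k₀ + 1) * (ENNReal.ofReal (139264 * (α * r ^ 2)) * Φ * volume (V i₀)) := by
  have hbdd : ∀ i ∈ s, Bornology.IsBounded (V i) := fun i hi =>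
    Metric.isBounded_iff.2 ⟨R, fun x hx y hy => hR i hi x hx y hy⟩
  -- the axis of `V i₀`
  obtain ⟨p, hp, q, hq, hpq, hpq2⟩ : ∃ p ∈ V i₀, ∃ q ∈ V i₀, 0 < dist p q ∧
      Metric.diam (V i₀) ≤ 2 * dist p q := by
    have hnt : (V i₀).Nontrivial := by
      rw [← Set.not_subsingleton_iff]
      exact fun h => hpos i₀ hi₀ (h.measure_zero _)
    have hdp : 0 < Metric.diam (V i₀) := Metric.diam_pos hnt (hbdd i₀ hi₀)
    by_contra! hcon
    have : Metric.diam (V i₀) ≤ Metric.diam (V i₀) / 2 :=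
      Metric.diam_le_of_forall_dist_le (by positivity) fun x hx y hy => by
        by_contra! h
        linarith [hcon x hx y hy (by linarith)]
    linarith
  set D := dist p q with hD
  set e : E3 := D⁻¹ • (q - p) with he
  have he1 : ‖e‖ = 1 := by
    rw [he, norm_smul, ← dist_eq_norm, dist_comm q p, ← hD, norm_inv, Real.norm_eq_abs,
      abs_of_pos hpq, inv_mul_cancel₀ hpq.ne']
  have hqe : p + D • e = q := by
    rw [he, smul_smul, mul_inv_cancel₀ hpq.ne', one_smul]; abel
  have hα : 0 ≤ α := (abs_nonneg _).trans (hslab p (hsub i₀ hi₀ hp) p (hsub i₀ hi₀ hp))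
  set N := ⌊D / (4 * r)⌋₊ + 1 with hN
  have hND : 4 * D + r ≤ 17 * r * N := by
    have h1 := Nat.lt_floor_add_one (D / (4 * r))
    rw [div_lt_iff₀ (by positivity)] at h1
    have h2 : (N : ℝ) = ⌊D / (4 * r)⌋₊ + 1 := by rw [hN]; push_cast; ring
    have h3 : (1 : ℝ) ≤ N := by rw [hN]; push_cast; linarith [Nat.cast_nonneg (α := ℝ) ⌊D / (4 * r)⌋₊]
    rw [← h2] at h1
    nlinarith
  -- the convex set that holds the members of the `k`-th class
  set K : ℕ → Set E3 := fun k =>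
    (W ∩ perp e ⁻¹' Metric.closedBall (perp e p) (2 ^ k * r)) ∩ Metric.closedBall p (4 * D + r)
    with hK
  have hKconv : ∀ k, Convex ℝ (K k) := fun k =>
    (hW.inter ((convex_closedBall _ _).linear_preimage _)).inter (convex_closedBall _ _)
  have hKvol : ∀ k, volume (K k) ≤ ENNReal.ofReal (136 * (α * r ^ 2)) * (N * 2 ^ k) := by
    intro k
    refine (volume_slab_cylinder_le (e := e) hn p hα (by positivity : 0 ≤ 2 ^ k * r)
      (by positivity : 0 ≤ 4 * D + r) (fun x hx => hslab x hx.1.1 p (hsub i₀ hi₀ hp))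
      (fun x hx => ?_) (fun x hx => ?_)).trans ?_
    · have := hx.1.2
      rwa [Set.mem_preimage, mem_closedBall_iff_norm, ← map_sub] at this
    · exact mem_closedBall_iff_norm.1 hx.2
    · have h1 : ((N : ℝ≥0∞) * 2 ^ k) = ENNReal.ofReal (N * 2 ^ k) := by
        rw [ENNReal.ofReal_mul (by positivity), ENNReal.ofReal_natCast,
          ENNReal.ofReal_pow (by norm_num), ENNReal.ofReal_ofNat]
      rw [h1, ← ENNReal.ofReal_mul (by positivity)]
      apply ENNReal.ofReal_le_ofReal
      have h2 : 0 ≤ α * (2 ^ k * r) := by positivity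
      nlinarith [mul_le_mul_of_nonneg_left hND h2]
  set t := {i ∈ s | Metric.diam (V i) ≤ Metric.diam (V i₀)} with ht
  -- every member that is close to `V i₀` belongs to one of the first `k₀ + 1` classes
  have hclass : ∀ i ∈ t, volume (closePairs r (V i₀) (V i)) ≠ 0 → ∃ k ∈ Finset.range (k₀ + 1),
      V i ⊆ K k ∧ ((N * 2 ^ k : ℕ) : ℝ≥0∞) * volume (closePairs r (V i₀) (V i))
        ≤ 1024 * (volume (V i₀) * volume (V i)) := by
    intro i hi hne
    obtain ⟨his, hid⟩ := Finset.mem_filter.1 hi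
    obtain ⟨⟨a, b⟩, ha, hb, hab⟩ : (closePairs r (V i₀) (V i)).Nonempty := by
      rw [Set.nonempty_iff_ne_empty]; intro h; rw [h] at hne; simp at hne
    simp only at ha hb hab
    have hfar : ∀ z ∈ V i, ‖z - p‖ ≤ 4 * D + r := by
      intro z hz
      have h1 : dist z b ≤ Metric.diam (V i) := Metric.dist_le_diam_of_mem (hbdd i his) hz hb
      have h2 : dist a p ≤ Metric.diam (V i₀) := Metric.dist_le_diam_of_mem (hbdd i₀ hi₀) ha hp
      rw [← dist_eq_norm]
      have h3 := dist_triangle4 z b a p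
      rw [dist_comm b a] at h3
      linarith
    have hfar2 : 4 * D + r ≤ 2 ^ k₀ * r := by
      have := hR i₀ hi₀ p hp q hq
      linarith
    have hex : ∃ k, ∀ z ∈ V i, ‖perp e (z - p)‖ ≤ 2 ^ k * r :=
      ⟨k₀, fun z hz => (norm_perp_le he1 _).trans ((hfar z hz).trans hfar2)⟩
    set k := Nat.find hex with hk
    have hkspec : ∀ z ∈ V i, ‖perp e (z - p)‖ ≤ 2 ^ k * r := Nat.find_spec hex
    have hkle : k ≤ k₀ := Nat.find_min' hex
      fun z hz => (norm_perp_le he1 _).trans ((hfar z hz).trans hfar2)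
    refine ⟨k, Finset.mem_range.2 (Nat.lt_succ_iff.2 hkle), fun z hz => ⟨⟨hsub i his hz, ?_⟩, ?_⟩, ?_⟩
    · rw [Set.mem_preimage, mem_closedBall_iff_norm, ← map_sub]; exact hkspec z hz
    · exact mem_closedBall_iff_norm.2 (hfar z hz)
    · obtain ⟨z, hz, hzN⟩ : ∃ z ∈ V i,
          2 ^ k ≤ 16 * (⌊(‖perp e (z - p)‖ - r) / (4 * r)⌋₊ + 1) := by
        rcases Nat.eq_zero_or_pos k with h0 | h0
        · refine ⟨b, hb, ?_⟩
          rw [h0]; omega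
        · have h1 := Nat.find_min hex (m := k - 1) (by omega)
          push Not at h1
          obtain ⟨z, hz, h2⟩ := h1
          refine ⟨z, hz, ?_⟩
          have h3 := Nat.lt_floor_add_one ((‖perp e (z - p)‖ - r) / (4 * r))
          rw [div_lt_iff₀ (by positivity)] at h3
          have h4 : (2 : ℝ) ^ k = 2 * 2 ^ (k - 1) := by
            rw [← pow_succ']; congr 1; omega
          have h5 : (0 : ℝ) ≤ ⌊(‖perp e (z - p)‖ - r) / (4 * r)⌋₊ := Nat.cast_nonneg _
          have h6 : (2 : ℝ) ^ k * r
              ≤ (16 * (⌊(‖perp e (z - p)‖ - r) / (4 * r)⌋₊ + 1)) * r := by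
            rw [h4]; nlinarith
          have h7 := le_of_mul_le_mul_right h6 hr
          exact_mod_cast h7
      have h1 := mul_volume_closePairs_le (hconv i₀ hi₀) (hconv i his) hr hpq he1 hp
        (by rwa [hqe]) hz
      rw [← hN] at h1
      calc ((N * 2 ^ k : ℕ) : ℝ≥0∞) * volume (closePairs r (V i₀) (V i))
          ≤ ((16 * (N * (⌊(‖perp e (z - p)‖ - r) / (4 * r)⌋₊ + 1)) : ℕ) : ℝ≥0∞) *
              volume (closePairs r (V i₀) (V i)) := by
            gcongr ?_ * _
            exact_mod_cast (Nat.mul_le_mul_left N hzN).trans (le_of_eq (by ring))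
        _ ≤ 16 * (64 * (volume (V i₀) * volume (V i))) := by
            rw [Nat.cast_mul, mul_assoc]
            gcongr
            simp
        _ = _ := by rw [← mul_assoc]; norm_num
  set T : ℕ → Finset ι := fun k => {i ∈ t | V i ⊆ K k ∧
      ((N * 2 ^ k : ℕ) : ℝ≥0∞) * volume (closePairs r (V i₀) (V i))
        ≤ 1024 * (volume (V i₀) * volume (V i))} with hT
  have hTsum : ∀ k, ∑ i ∈ T k, volume (closePairs r (V i₀) (V i))
      ≤ ENNReal.ofReal (139264 * (α * r ^ 2)) * Φ * volume (V i₀) := by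
    intro k
    have hN0 : ((N * 2 ^ k : ℕ) : ℝ≥0∞) ≠ 0 := by
      rw [Nat.cast_ne_zero]; positivity
    rw [← ENNReal.mul_le_mul_iff_right hN0 (ENNReal.natCast_ne_top _), Finset.mul_sum]
    calc ∑ i ∈ T k, ((N * 2 ^ k : ℕ) : ℝ≥0∞) * volume (closePairs r (V i₀) (V i))
        ≤ ∑ i ∈ T k, 1024 * (volume (V i₀) * volume (V i)) :=
          Finset.sum_le_sum fun i hi => (Finset.mem_filter.1 hi).2.2
      _ = 1024 * volume (V i₀) * ∑ i ∈ T k, volume (V i) := by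
          rw [Finset.mul_sum]; exact Finset.sum_congr rfl fun i _ => by ring
      _ ≤ 1024 * volume (V i₀) * ∑ i ∈ s with V i ⊆ K k, volume (V i) := by
          gcongr
          intro i hi
          obtain ⟨h1, h2, -⟩ := Finset.mem_filter.1 hi
          exact Finset.mem_filter.2 ⟨(Finset.mem_filter.1 h1).1, h2⟩
      _ ≤ 1024 * volume (V i₀) * (Φ * (ENNReal.ofReal (136 * (α * r ^ 2)) * (N * 2 ^ k))) := by
          gcongr
          refine (hF (K k) (hKconv k) (fun x hx => hx.1.1)
            (Metric.isBounded_closedBall.subset Set.inter_subset_right)).trans ?_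
          gcongr
          exact hKvol k
      _ = _ := by
          have : ENNReal.ofReal (139264 * (α * r ^ 2))
              = 1024 * ENNReal.ofReal (136 * (α * r ^ 2)) := by
            rw [← ENNReal.ofReal_ofNat 1024, ← ENNReal.ofReal_mul (by norm_num)]
            congr 1; ring
          rw [this]; push_cast; ring
  calc ∑ i ∈ t, volume (closePairs r (V i₀) (V i))
      ≤ ∑ i ∈ t, ∑ k ∈ Finset.range (k₀ + 1),
          if i ∈ T k then volume (closePairs r (V i₀) (V i)) else 0 := by
        refine Finset.sum_le_sum fun i hi => ?_
        by_cases h0 : volume (closePairs r (V i₀) (V i)) = 0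
        · rw [h0]; exact zero_le
        · obtain ⟨k, hk, h1⟩ := hclass i hi h0
          refine le_trans (le_of_eq ?_) (Finset.single_le_sum (fun _ _ => zero_le) hk)
          rw [if_pos (Finset.mem_filter.2 ⟨hi, h1⟩)]
    _ = ∑ k ∈ Finset.range (k₀ + 1), ∑ i ∈ T k, volume (closePairs r (V i₀) (V i)) := by
        rw [Finset.sum_comm]
        refine Finset.sum_congr rfl fun k _ => ?_
        rw [← Finset.sum_filter]
        congr 1
        ext i; simp [hT]
    _ ≤ ∑ k ∈ Finset.range (k₀ + 1), ENNReal.ofReal (139264 * (α * r ^ 2)) * Φ * volume (V i₀) :=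
        Finset.sum_le_sum fun k _ => hTsum k
    _ = _ := by rw [Finset.sum_const, Finset.card_range, nsmul_eq_mul]; push_cast; rfl

open Classical in
/-- Córdoba's `L²` estimate at scale `r` for a Frostman family in a slab of width `α`. -/
lemma sum_sum_volume_closePairs_le {s : Finset ι} {V : ι → Set E3} {W : Set E3} {r α R : ℝ}
    {Φ : ℝ≥0∞} {k₀ : ℕ} (hconv : ∀ i ∈ s, Convex ℝ (V i)) (hW : Convex ℝ W)
    (hsub : ∀ i ∈ s, V i ⊆ W) (hr : 0 < r) {n : E3} (hn : ‖n‖ = 1)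
    (hslab : ∀ x ∈ W, ∀ y ∈ W, |inner ℝ n (x - y)| ≤ α)
    (hF : ∀ K : Set E3, Convex ℝ K → K ⊆ W → Bornology.IsBounded K →
      ∑ i ∈ s with V i ⊆ K, volume (V i) ≤ Φ * volume K)
    (hR : ∀ i ∈ s, ∀ x ∈ V i, ∀ y ∈ V i, dist x y ≤ R) (hk₀ : 4 * R + r ≤ 2 ^ k₀ * r)
    (hpos : ∀ i ∈ s, volume (V i) ≠ 0) :
    ∑ i ∈ s, ∑ j ∈ s, volume (closePairs r (V i) (V j))
      ≤ 2 * ((k₀ + 1) * (ENNReal.ofReal (139264 * (α * r ^ 2)) * Φ * ∑ i ∈ s, volume (V i))) := by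
  set S : ι → ι → ℝ≥0∞ := fun i j => volume (closePairs r (V i) (V j)) with hS
  set δ : ι → ℝ := fun i => Metric.diam (V i) with hδ
  have h1 : ∑ i ∈ s, ∑ j ∈ s, S i j
      ≤ ∑ i ∈ s, ∑ j ∈ s, ((if δ j ≤ δ i then S i j else 0) + (if δ i ≤ δ j then S j i else 0)) := by
    refine Finset.sum_le_sum fun i _ => Finset.sum_le_sum fun j _ => ?_
    rcases le_total (δ j) (δ i) with h | h
    · rw [if_pos h]; exact le_self_add
    · rw [if_pos h]
      refine le_trans (le_of_eq ?_) le_add_self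
      exact volume_closePairs_comm _ _ _
  have h2 : ∑ i ∈ s, ∑ j ∈ s, (if δ i ≤ δ j then S j i else 0)
      = ∑ i ∈ s, ∑ j ∈ s, (if δ j ≤ δ i then S i j else 0) := Finset.sum_comm
  have h3 : ∑ i ∈ s, ∑ j ∈ s, (if δ j ≤ δ i then S i j else 0)
      ≤ (k₀ + 1) * (ENNReal.ofReal (139264 * (α * r ^ 2)) * Φ * ∑ i ∈ s, volume (V i)) := by
    rw [Finset.mul_sum, Finset.mul_sum]
    refine Finset.sum_le_sum fun i hi => ?_
    rw [← Finset.sum_filter]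
    exact sum_volume_closePairs_le_of_diam_le hconv hW hsub hr hn hslab hF hR hk₀ hi hpos
  calc _ ≤ _ := h1
    _ = 2 * ∑ i ∈ s, ∑ j ∈ s, (if δ j ≤ δ i then S i j else 0) := by
      simp only [Finset.sum_add_distrib]
      rw [h2, two_mul]
    _ ≤ _ := by gcongr

end Cordoba

/-! ### The grid and the multiplicity function -/

/-- The index of the cube of side `s` of the standard grid that contains `x`. -/
noncomputable def gridIndex (s : ℝ) (x : E3) : Fin 3 → ℤ := fun k => ⌊x k / s⌋

/-- The half-open cube of side `s` of the standard grid with index `z`. -/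
def gridCube (s : ℝ) (z : Fin 3 → ℤ) : Set E3 := {x | gridIndex s x = z}

lemma measurable_gridIndex (s : ℝ) : Measurable (gridIndex s) :=
  measurable_pi_lambda _ fun k => Int.measurable_floor.comp
    (((measurable_pi_apply k).comp (PiLp.volume_preserving_ofLp (Fin 3)).measurable).div_const s)

lemma measurableSet_gridCube (s : ℝ) (z : Fin 3 → ℤ) : MeasurableSet (gridCube s z) :=
  measurable_gridIndex s (MeasurableSet.singleton z)

lemma volume_gridCube {s : ℝ} (hs : 0 < s) (z : Fin 3 → ℤ) :
    volume (gridCube s z) = ENNReal.ofReal (s ^ 3) := by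
  have h1 : gridCube s z
      = WithLp.ofLp ⁻¹' (Set.univ.pi fun k => Set.Ico ((z k : ℝ) * s) ((z k + 1 : ℝ) * s)) := by
    ext x
    simp only [gridCube, gridIndex, Set.mem_ofPred_eq, Set.mem_preimage, Set.mem_univ_pi,
      Set.mem_Ico, funext_iff]
    refine forall_congr' fun k => ?_
    rw [Int.floor_eq_iff, le_div_iff₀ hs, div_lt_iff₀ hs]
  rw [h1, (PiLp.volume_preserving_ofLp (Fin 3)).measure_preimage
    (MeasurableSet.univ_pi fun k => measurableSet_Ico).nullMeasurableSet, Real.volume_pi_Ico,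
    ← ENNReal.ofReal_prod_of_nonneg]
  · congr 1
    rw [Fin.prod_univ_three]; ring
  · intro k _; nlinarith

lemma dist_lt_of_gridIndex_eq {s : ℝ} (hs : 0 < s) {x y : E3}
    (h : gridIndex s x = gridIndex s y) : dist x y < 2 * s := by
  have h1 : ∀ k, (x k - y k) ^ 2 ≤ s ^ 2 := by
    intro k
    have h2 := Int.abs_sub_lt_one_of_floor_eq_floor (congrFun h k)
    rw [← sub_div, abs_div, abs_of_pos hs, div_lt_one hs] at h2
    rw [← sq_abs]
    gcongr
  rw [EuclideanSpace.dist_eq, Real.sqrt_lt' (by positivity), Fin.sum_univ_three]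
  simp only [Real.dist_eq, sq_abs]
  nlinarith [h1 0, h1 1, h1 2]

lemma abs_sub_le_dist (x y : E3) (k : Fin 3) : |x k - y k| ≤ dist x y := by
  rw [dist_eq_norm]; exact PiLp.norm_apply_le (x - y) k

/-- Points at distance less than `M` sides from `x` lie in the `(2M + 1) ^ 3` cubes around that of
`x`. -/
lemma gridIndex_mem_piFinset {s : ℝ} (hs : 0 < s) {x y : E3} {M : ℕ}
    (h : dist y x < M * s) :
    gridIndex s y ∈ Fintype.piFinset
      fun k => Finset.Icc (gridIndex s x k - M) (gridIndex s x k + M) := by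
  rw [Fintype.mem_piFinset]
  intro k
  have h1 := (abs_sub_le_dist y x k).trans_lt h
  rw [← div_lt_iff₀ hs, show |y k - x k| / s = |(y k - x k) / s| by rw [abs_div, abs_of_pos hs],
    sub_div, abs_lt] at h1
  simp only [gridIndex, Finset.mem_Icc]
  have hx := Int.floor_le (x k / s)
  have hx' := Int.lt_floor_add_one (x k / s)
  have hy := Int.floor_le (y k / s)
  have hy' := Int.lt_floor_add_one (y k / s)
  constructor
  · rw [← Int.lt_add_one_iff]
    have : (⌊x k / s⌋ : ℝ) - M < ⌊y k / s⌋ + 1 := by linarith [h1.1]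
    exact_mod_cast this
  · rw [← Int.lt_add_one_iff]
    have : (⌊y k / s⌋ : ℝ) < ⌊x k / s⌋ + M + 1 := by linarith [h1.2]
    exact_mod_cast this

lemma card_piFinset_Icc (z : Fin 3 → ℤ) (M : ℕ) :
    (Fintype.piFinset fun k => Finset.Icc (z k - M) (z k + M)).card = (2 * M + 1) ^ 3 := by
  rw [Fintype.card_piFinset, Fin.prod_univ_three]
  simp only [Int.card_Icc]
  have : ∀ a : ℤ, (a + M + 1 - (a - M)).toNat = 2 * M + 1 := by intro a; omega
  rw [this, this, this]; ring

lemma sum_measure_inter_eq {α β : Type*} [MeasurableSpace α] (μ : Measure α) (A : Set α)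
    (𝒬 : Finset β) {t : β → Set α} (ht : ∀ z ∈ 𝒬, MeasurableSet (t z))
    (hd : Set.PairwiseDisjoint (𝒬 : Set β) t) :
    ∑ z ∈ 𝒬, μ (A ∩ t z) = μ (A ∩ ⋃ z ∈ 𝒬, t z) := by
  have h1 := measure_biUnion_finset (μ := μ.restrict A) hd ht
  rw [Measure.restrict_apply (Finset.measurableSet_biUnion _ ht)] at h1
  rw [Set.inter_comm, h1]
  refine Finset.sum_congr rfl fun z hz => ?_
  rw [Measure.restrict_apply (ht z hz), Set.inter_comm]

lemma pairwiseDisjoint_gridCube (s : ℝ) (S : Set (Fin 3 → ℤ)) :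
    S.PairwiseDisjoint (gridCube s) := fun _ _ _ _ hne =>
  Set.disjoint_left.2 fun _ hx hx' => hne (Eq.trans (Eq.symm hx) hx')

lemma sum_volume_inter_gridCube (s : ℝ) (A : Set E3) (𝒬 : Finset (Fin 3 → ℤ)) :
    ∑ z ∈ 𝒬, volume (A ∩ gridCube s z) = volume (A ∩ {x | gridIndex s x ∈ 𝒬}) := by
  rw [sum_measure_inter_eq volume A 𝒬 (fun z _ => measurableSet_gridCube s z)
    (pairwiseDisjoint_gridCube s _)]
  congr 2
  ext x; simp [gridCube]

lemma sum_volume_inter_gridCube_of_subset {s : ℝ} {A : Set E3} {𝒬 : Finset (Fin 3 → ℤ)}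
    (h : ∀ x ∈ A, gridIndex s x ∈ 𝒬) : ∑ z ∈ 𝒬, volume (A ∩ gridCube s z) = volume A := by
  rw [sum_volume_inter_gridCube]
  congr 1
  exact Set.inter_eq_left.2 h

lemma volume_gridIndex_mem {s : ℝ} (hs : 0 < s) (𝒬 : Finset (Fin 3 → ℤ)) :
    volume {x : E3 | gridIndex s x ∈ 𝒬} = 𝒬.card * ENNReal.ofReal (s ^ 3) := by
  rw [← Set.univ_inter {x : E3 | gridIndex s x ∈ 𝒬}, ← sum_volume_inter_gridCube]
  simp [volume_gridCube hs]

lemma ENNReal.two_mul_mul_le_sq_add_sq (a b : ℝ≥0∞) : 2 * (a * b) ≤ a ^ 2 + b ^ 2 := by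
  have key : ∀ a b : ℝ≥0∞, a ≤ b → 2 * (a * b) ≤ a ^ 2 + b ^ 2 := by
    intro a b h
    obtain ⟨c, rfl⟩ := exists_add_of_le h
    calc 2 * (a * (a + c)) ≤ 2 * (a * (a + c)) + c ^ 2 := le_self_add
      _ = a ^ 2 + (a + c) ^ 2 := by ring
  rcases le_total a b with h | h
  · exact key a b h
  · rw [mul_comm a b, add_comm]; exact key b a h

lemma ENNReal.sum_sq_le_card_mul {α : Type*} (s : Finset α) (f : α → ℝ≥0∞) :
    (∑ i ∈ s, f i) ^ 2 ≤ s.card * ∑ i ∈ s, f i ^ 2 := by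
  have h1 : 2 * (∑ i ∈ s, f i) ^ 2 ≤ 2 * (s.card * ∑ i ∈ s, f i ^ 2) := by
    calc 2 * (∑ i ∈ s, f i) ^ 2 = ∑ i ∈ s, ∑ j ∈ s, 2 * (f i * f j) := by
          rw [sq, Finset.sum_mul_sum, Finset.mul_sum]
          simp only [Finset.mul_sum]
      _ ≤ ∑ i ∈ s, ∑ j ∈ s, (f i ^ 2 + f j ^ 2) :=
          Finset.sum_le_sum fun i _ => Finset.sum_le_sum fun j _ => two_mul_mul_le_sq_add_sq _ _
      _ = _ := by
          simp only [Finset.sum_add_distrib, Finset.sum_const, nsmul_eq_mul, ← Finset.mul_sum]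
          rw [two_mul]
  rwa [ENNReal.mul_le_mul_iff_right two_ne_zero ENNReal.ofNat_ne_top] at h1

/-- Cauchy–Schwarz over the cubes of the grid that the shading meets: two points of one cube of
side `s` are at distance less than `2s`. -/
lemma mass_sq_le {ι : Type*} {S : Finset ι} {V Y : ι → Set E3} {s : ℝ} (hs : 0 < s)
    {𝒬 : Finset (Fin 3 → ℤ)} (hYV : ∀ i ∈ S, Y i ⊆ V i)
    (h𝒬 : ∀ i ∈ S, ∀ x ∈ Y i, gridIndex s x ∈ 𝒬) :
    mass S Y ^ 2
      ≤ 𝒬.card * ∑ i ∈ S, ∑ j ∈ S, volume (closePairs (2 * s) (V i) (V j)) := by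
  have h1 : mass S Y = ∑ z ∈ 𝒬, ∑ i ∈ S, volume (Y i ∩ gridCube s z) := by
    rw [Finset.sum_comm]
    exact Finset.sum_congr rfl fun i hi => (sum_volume_inter_gridCube_of_subset (h𝒬 i hi)).symm
  rw [h1]
  refine (ENNReal.sum_sq_le_card_mul _ _).trans ?_
  gcongr
  calc ∑ z ∈ 𝒬, (∑ i ∈ S, volume (Y i ∩ gridCube s z)) ^ 2
      = ∑ i ∈ S, ∑ j ∈ S, ∑ z ∈ 𝒬, volume (Y i ∩ gridCube s z) * volume (Y j ∩ gridCube s z) := by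
        simp only [sq, Finset.sum_mul_sum]
        rw [Finset.sum_comm]
        exact Finset.sum_congr rfl fun i _ => Finset.sum_comm
    _ ≤ _ := by
        refine Finset.sum_le_sum fun i hi => Finset.sum_le_sum fun j hj => ?_
        calc ∑ z ∈ 𝒬, volume (Y i ∩ gridCube s z) * volume (Y j ∩ gridCube s z)
            ≤ ∑ z ∈ 𝒬, volume (closePairs (2 * s) (V i) (V j) ∩ gridCube s z ×ˢ gridCube s z) := by
              refine Finset.sum_le_sum fun z _ => ?_
              rw [← Measure.prod_prod, ← Measure.volume_eq_prod]
              refine measure_mono ?_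
              rintro ⟨x, y⟩ ⟨⟨hx, hxz⟩, hy, hyz⟩
              exact ⟨⟨hYV i hi hx, hYV j hj hy,
                dist_lt_of_gridIndex_eq hs (Eq.trans hxz (Eq.symm hyz))⟩, hxz, hyz⟩
          _ = volume (closePairs (2 * s) (V i) (V j) ∩ ⋃ z ∈ 𝒬, gridCube s z ×ˢ gridCube s z) :=
              sum_measure_inter_eq _ _ _ (fun z _ =>
                (measurableSet_gridCube s z).prod (measurableSet_gridCube s z))
                (fun z hz z' hz' hne => Set.disjoint_left.2 fun q hq hq' =>
                  (Set.disjoint_left.1 (pairwiseDisjoint_gridCube s Set.univ (Set.mem_univ z)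
                    (Set.mem_univ z') hne)) hq.1 hq'.1)
          _ ≤ _ := measure_mono Set.inter_subset_left

section Multiplicity

variable {ι κ : Type*}

lemma multiplicityAt_eq_card (S : Finset ι) (Y : ι → Set E3) (x : E3)
    [DecidablePred fun i => x ∈ Y i] :
    multiplicityAt S Y x = (S.filter fun i => x ∈ Y i).card := by
  rw [multiplicityAt, ← Set.ncard_coe_finset]
  congr 1
  ext i; simp [incident]

lemma mem_shadedUnion {S : Finset ι} {Y : ι → Set E3} {x : E3} :
    x ∈ shadedUnion S Y ↔ ∃ i ∈ S, x ∈ Y i := by simp [shadedUnion]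

lemma mem_part {S : Finset ι} {p : ι → κ} {j : κ} {i : ι} :
    i ∈ part S p j ↔ i ∈ S ∧ p i = j := by simp [part]

lemma multiplicityAt_ne_zero {S : Finset ι} {Y : ι → Set E3} {x : E3} :
    multiplicityAt S Y x ≠ 0 ↔ x ∈ shadedUnion S Y := by
  classical
  rw [multiplicityAt_eq_card, mem_shadedUnion, Finset.card_ne_zero, Finset.filter_nonempty_iff]

lemma multiplicityAt_le_card (S : Finset ι) (Y : ι → Set E3) (x : E3) :
    multiplicityAt S Y x ≤ S.card := by
  classical
  rw [multiplicityAt_eq_card]; exact Finset.card_filter_le _ _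

lemma measurable_multiplicityAt {S : Finset ι} {Y : ι → Set E3}
    (hY : ∀ i ∈ S, MeasurableSet (Y i)) : Measurable (multiplicityAt S Y) := by
  classical
  have : multiplicityAt S Y = fun x => ∑ i ∈ S, (Y i).indicator (fun _ => 1) x := by
    ext x
    rw [multiplicityAt_eq_card, Finset.card_filter]
    exact Finset.sum_congr rfl fun i _ => by simp [Set.indicator_apply]
  rw [this]
  exact Finset.measurable_sum _ fun i hi => measurable_const.indicator (hY i hi)

lemma measurableSet_shadedUnion {S : Finset ι} {Y : ι → Set E3}
    (hY : ∀ i ∈ S, MeasurableSet (Y i)) : MeasurableSet (shadedUnion S Y) :=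
  Finset.measurableSet_biUnion _ hY

lemma mass_eq_lintegral {S : Finset ι} {Y : ι → Set E3} (hY : ∀ i ∈ S, MeasurableSet (Y i)) :
    mass S Y = ∫⁻ x in shadedUnion S Y, (multiplicityAt S Y x : ℝ≥0∞) := by
  classical
  have h1 : ∀ x, (multiplicityAt S Y x : ℝ≥0∞) = ∑ i ∈ S, (Y i).indicator 1 x := by
    intro x
    rw [multiplicityAt_eq_card, Finset.card_filter, Nat.cast_sum]
    exact Finset.sum_congr rfl fun i _ => by simp [Set.indicator_apply]
  simp only [h1]
  rw [lintegral_finsetSum' _ fun i hi => (measurable_one.indicator (hY i hi)).aemeasurable]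
  refine Finset.sum_congr rfl fun i hi => ?_
  rw [lintegral_indicator_one (hY i hi), Measure.restrict_apply (hY i hi), Set.inter_eq_left.2]
  exact fun x hx => mem_shadedUnion.2 ⟨i, hi, hx⟩

lemma mass_le_mul_volume {S : Finset ι} {Y : ι → Set E3} (hY : ∀ i ∈ S, MeasurableSet (Y i))
    {m : ℕ} (h : ∀ x ∈ shadedUnion S Y, multiplicityAt S Y x ≤ m) :
    mass S Y ≤ m * volume (shadedUnion S Y) := by
  rw [mass_eq_lintegral hY, ← setLIntegral_const]
  exact setLIntegral_mono measurable_const fun x hx => by exact_mod_cast h x hx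

lemma mul_volume_le_mass {S : Finset ι} {Y : ι → Set E3} (hY : ∀ i ∈ S, MeasurableSet (Y i))
    {m : ℕ} (h : ∀ x ∈ shadedUnion S Y, m ≤ multiplicityAt S Y x) :
    m * volume (shadedUnion S Y) ≤ mass S Y := by
  rw [mass_eq_lintegral hY, ← setLIntegral_const]
  exact setLIntegral_mono' (measurableSet_shadedUnion hY) fun x hx => by exact_mod_cast h x hx

lemma volume_shadedUnion_le_mass (S : Finset ι) (Y : ι → Set E3) :
    volume (shadedUnion S Y) ≤ mass S Y := measure_biUnion_finset_le S Y

end Multiplicity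

/-- A shading can be restricted to one of `n` classes of points (the classes may depend on the
member of the family) at the cost of a factor `n` in its mass. -/
lemma exists_mass_le_mul_mass_class {ι : Type*} (S : Finset ι) (Y : ι → Set E3) (g : ι → E3 → ℕ)
    {n : ℕ} (hn : 0 < n) (hg : ∀ i ∈ S, ∀ x ∈ Y i, g i x < n) :
    ∃ c < n, mass S Y ≤ n * mass S fun i => Y i ∩ {x | g i x = c} := by
  set F : ℕ → ℝ≥0∞ := fun c => mass S fun i => Y i ∩ {x | g i x = c} with hF
  obtain ⟨c, hc, hmax⟩ := Finset.exists_max_image (Finset.range n) F ⟨0, Finset.mem_range.2 hn⟩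
  refine ⟨c, Finset.mem_range.1 hc, ?_⟩
  calc mass S Y ≤ ∑ i ∈ S, ∑ c ∈ Finset.range n, volume (Y i ∩ {x | g i x = c}) := by
        refine Finset.sum_le_sum fun i hi => ?_
        refine (measure_mono ?_).trans (measure_biUnion_finset_le (Finset.range n) _)
        intro x hx
        simp only [Set.mem_iUnion]
        exact ⟨g i x, Finset.mem_range.2 (hg i hi x hx), hx, rfl⟩
    _ = ∑ c ∈ Finset.range n, F c := Finset.sum_comm
    _ ≤ ∑ _c ∈ Finset.range n, F c := Finset.sum_le_sum hmax
    _ = _ := by rw [Finset.sum_const, Finset.card_range, nsmul_eq_mul]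

/-! ### Dyadic pigeonholing of parts and cubes -/

section Refinement

variable {ι κ : Type*} [Fintype ι]

/-- The union of the shadings of the members of `𝕍_W`, where `j` is the index of `W`. -/
def partUnion (p : ι → κ) (Y : ι → Set E3) (j : κ) : Set E3 :=
  shadedUnion (part Finset.univ p j) Y

lemma mem_partUnion {p : ι → κ} {Y : ι → Set E3} {j : κ} {x : E3} :
    x ∈ partUnion p Y j ↔ ∃ i, p i = j ∧ x ∈ Y i := by
  simp [partUnion, mem_shadedUnion, mem_part]

/-- Restricting the shadings in `𝕍_W` to a common set does not change their multiplicity there. -/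
lemma multiplicityAt_part_inter {p : ι → κ} {Y : ι → Set E3} {Z : κ → Set E3} {j : κ} {x : E3}
    (hx : x ∈ Z j) :
    multiplicityAt (part Finset.univ p j) (fun i => Y i ∩ Z (p i)) x
      = multiplicityAt (part Finset.univ p j) Y x := by
  unfold multiplicityAt
  congr 1
  ext i
  simp only [incident, Set.mem_ofPred_eq, mem_part, Set.mem_inter_iff]
  constructor
  · rintro ⟨h1, h2, -⟩; exact ⟨h1, h2⟩
  · rintro ⟨h1, h2⟩; exact ⟨h1, h2, by rw [h1.2]; exact hx⟩

/-- Constant multiplicity within the parts survives restriction to sets that depend only on the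
part. -/
lemma HasConstantMultiplicity.inter {p : ι → κ} {Y : ι → Set E3} {j : κ} {K m : ℕ}
    (h : HasConstantMultiplicity K m (part Finset.univ p j) Y) (Z : κ → Set E3) :
    HasConstantMultiplicity K m (part Finset.univ p j) fun i => Y i ∩ Z (p i) := by
  intro x hx
  obtain ⟨i, hi, hxi⟩ := mem_shadedUnion.1 hx
  have hpi : p i = j := (mem_part.1 hi).2
  rw [multiplicityAt_part_inter (hpi ▸ hxi.2)]
  exact h x (mem_shadedUnion.2 ⟨i, hi, hxi.1⟩)

lemma natLog_bounds {a c : ℕ} (h : Nat.log 2 a = c) (ha : a ≠ 0) : 2 ^ c ≤ a ∧ a ≤ 2 * 2 ^ c := by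
  rw [Nat.log_eq_iff (Or.inr ⟨one_lt_two, ha⟩), pow_succ'] at h
  exact ⟨h.1, h.2.le⟩

lemma natLog_lt {a b : ℕ} (h : a ≤ b) : Nat.log 2 a < Nat.log 2 b + 1 :=
  Nat.lt_succ_of_le (Nat.log_mono_right h)

/-- Two dyadic pigeonholings: restrict the shading so that all parts in use have about the same
number of members, and all parts have about the same multiplicity. -/
lemma exists_uniform_parts (p : ι → κ) {Y : ι → Set E3} (hY : ∀ i, MeasurableSet (Y i)) :
    ∃ (Y₁ : ι → Set E3) (a m : ℕ), (∀ i, MeasurableSet (Y₁ i)) ∧ (∀ i, Y₁ i ⊆ Y i) ∧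
      (∀ i, (Y₁ i).Nonempty → a ≤ (part Finset.univ p (p i)).card ∧
        (part Finset.univ p (p i)).card ≤ 2 * a) ∧
      (∀ j, HasConstantMultiplicity 2 m (part Finset.univ p j) Y₁) ∧
      mass Finset.univ Y
        ≤ ((Nat.log 2 (Fintype.card ι) + 1) ^ 2 : ℕ) * mass Finset.univ Y₁ := by
  set n := Nat.log 2 (Fintype.card ι) + 1 with hn
  obtain ⟨c, -, hc⟩ := exists_mass_le_mul_mass_class Finset.univ Y
    (fun i _ => Nat.log 2 (part Finset.univ p (p i)).card) (n := n) (Nat.succ_pos _)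
    (fun i _ x _ => natLog_lt (Finset.card_le_univ _))
  set Y₀ : ι → Set E3 := fun i => Y i ∩ {_x | Nat.log 2 (part Finset.univ p (p i)).card = c}
    with hY₀
  have hY₀m : ∀ i, MeasurableSet (Y₀ i) := fun i => (hY i).inter (MeasurableSet.const _)
  have hmm : ∀ j, Measurable (multiplicityAt (part Finset.univ p j) Y₀) :=
    fun j => measurable_multiplicityAt fun i _ => hY₀m i
  obtain ⟨d, -, hd⟩ := exists_mass_le_mul_mass_class Finset.univ Y₀
    (fun i x => Nat.log 2 (multiplicityAt (part Finset.univ p (p i)) Y₀ x)) (n := n)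
    (Nat.succ_pos _)
    (fun i _ x _ => natLog_lt ((multiplicityAt_le_card _ _ _).trans (Finset.card_le_univ _)))
  set Z : κ → Set E3 := fun j => {x | Nat.log 2 (multiplicityAt (part Finset.univ p j) Y₀ x) = d}
    with hZ
  refine ⟨fun i => Y₀ i ∩ Z (p i), 2 ^ c, 2 ^ d, fun i => (hY₀m i).inter ?_,
    fun i x hx => hx.1.1, ?_, ?_, ?_⟩
  · have : Measurable fun x => Nat.log 2 (multiplicityAt (part Finset.univ p (p i)) Y₀ x) :=
      (measurable_from_top (f := Nat.log 2)).comp (hmm (p i))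
    exact this (MeasurableSet.singleton d)
  · rintro i ⟨x, ⟨-, hx⟩, -⟩
    exact natLog_bounds hx (Finset.card_ne_zero.2 ⟨i, mem_part.2 ⟨Finset.mem_univ i, rfl⟩⟩)
  · intro j x hx
    obtain ⟨i, hi, hxi⟩ := mem_shadedUnion.1 hx
    have hpi : p i = j := (mem_part.1 hi).2
    have hxZ : x ∈ Z j := hpi ▸ hxi.2
    rw [multiplicityAt_part_inter hxZ]
    exact natLog_bounds hxZ (multiplicityAt_ne_zero.2 (mem_shadedUnion.2 ⟨i, hi, hxi.1⟩))
  · refine hc.trans ?_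
    rw [sq, Nat.cast_mul, mul_assoc]
    gcongr

/-- Remove from the shading of each part its null pieces: after this a part that meets a cube of
the grid meets it in positive measure. -/
lemma exists_no_null_pieces (p : ι → κ) {Y : ι → Set E3} (s : ℝ)
    {𝒢 : Finset (Fin 3 → ℤ)} (h𝒢 : ∀ i, ∀ x ∈ Y i, gridIndex s x ∈ 𝒢) :
    ∃ Z : κ → Set E3, (∀ j, MeasurableSet (Z j)) ∧
      (∀ j z, (partUnion p (fun i => Y i ∩ Z (p i)) j ∩ gridCube s z).Nonempty →
        volume (partUnion p (fun i => Y i ∩ Z (p i)) j ∩ gridCube s z) ≠ 0) ∧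
      mass Finset.univ (fun i => Y i ∩ Z (p i)) = mass Finset.univ Y := by
  set Z : κ → Set E3 := fun j =>
    {x | volume (partUnion p Y j ∩ gridCube s (gridIndex s x)) ≠ 0} with hZ
  have hZm : ∀ j, MeasurableSet (Z j) := fun j =>
    measurable_gridIndex s (MeasurableSet.of_discrete
      (s := {z | volume (partUnion p Y j ∩ gridCube s z) ≠ 0}))
  have hU : ∀ j z, volume (partUnion p Y j ∩ gridCube s z) ≠ 0 →
      partUnion p Y j ∩ gridCube s z ⊆ partUnion p (fun i => Y i ∩ Z (p i)) j ∩ gridCube s z := by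
    rintro j z h0 x ⟨hx, hxz⟩
    obtain ⟨i, hi, hxi⟩ := mem_partUnion.1 hx
    refine ⟨mem_partUnion.2 ⟨i, hi, hxi, ?_⟩, hxz⟩
    rw [hi]
    change volume (partUnion p Y j ∩ gridCube s (gridIndex s x)) ≠ 0
    rwa [show gridIndex s x = z from hxz]
  refine ⟨Z, hZm, ?_, ?_⟩
  · rintro j z ⟨x, hx, hxz⟩ h0
    obtain ⟨i, hi, hxi⟩ := mem_partUnion.1 hx
    have h1 : volume (partUnion p Y j ∩ gridCube s z) ≠ 0 := by
      have := hxi.2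
      rw [hi] at this
      change volume (partUnion p Y j ∩ gridCube s (gridIndex s x)) ≠ 0 at this
      rwa [show gridIndex s x = z from hxz] at this
    exact h1 (measure_mono_null (hU j z h1) h0)
  · refine Finset.sum_congr rfl fun i _ => ?_
    refine le_antisymm (measure_mono Set.inter_subset_left) ?_
    rw [← sum_volume_inter_gridCube_of_subset (h𝒢 i), ← sum_volume_inter_gridCube_of_subset
      (A := Y i ∩ Z (p i)) (fun x hx => h𝒢 i x hx.1)]
    refine Finset.sum_le_sum fun z _ => ?_
    have hsub : Y i ∩ gridCube s z ⊆ partUnion p Y (p i) ∩ gridCube s z :=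
      fun x hx => ⟨mem_partUnion.2 ⟨i, rfl, hx.1⟩, hx.2⟩
    by_cases h0 : volume (partUnion p Y (p i) ∩ gridCube s z) = 0
    · rw [measure_mono_null hsub h0]; exact zero_le
    · refine measure_mono fun x hx => ⟨⟨hx.1, ?_⟩, hx.2⟩
      change volume (partUnion p Y (p i) ∩ gridCube s (gridIndex s x)) ≠ 0
      rwa [show gridIndex s x = z from hx.2]

variable [Fintype κ]

open Classical in
/-- The parts that meet the cube with index `z`. -/
noncomputable def partsMeeting (p : ι → κ) (Y : ι → Set E3) (s : ℝ) (z : Fin 3 → ℤ) : Finset κ :=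
  Finset.univ.filter fun j => (partUnion p Y j ∩ gridCube s z).Nonempty

lemma mem_partsMeeting {p : ι → κ} {Y : ι → Set E3} {s : ℝ} {z : Fin 3 → ℤ} {j : κ} :
    j ∈ partsMeeting p Y s z ↔ (partUnion p Y j ∩ gridCube s z).Nonempty := by
  simp [partsMeeting]

lemma card_partsMeeting_le (p : ι → κ) (Y : ι → Set E3) (s : ℝ) (z : Fin 3 → ℤ) :
    (partsMeeting p Y s z).card ≤ Fintype.card ι := by
  classical
  have h : partsMeeting p Y s z ⊆ Finset.univ.image p := by
    intro j hj
    obtain ⟨x, hx, -⟩ := mem_partsMeeting.1 hj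
    obtain ⟨i, hi, -⟩ := mem_partUnion.1 hx
    exact Finset.mem_image.2 ⟨i, Finset.mem_univ i, hi⟩
  exact (Finset.card_le_card h).trans (Finset.card_image_le.trans (Finset.card_le_univ _))

/-- The cubes where the volume of the shaded union is at most `M / (2 n N)` carry at most half of the
mass, where `n` is the number of sets, `N` that of cubes, and `M` is at most the mass. -/
lemma mass_le_two_mul_mass_good {Y : ι → Set E3} {s : ℝ} (hfin : mass Finset.univ Y ≠ ∞)
    {𝒢 : Finset (Fin 3 → ℤ)} (h𝒢 : ∀ i, ∀ x ∈ Y i, gridIndex s x ∈ 𝒢) {M : ℝ≥0∞}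
    (hM : M ≤ mass Finset.univ Y) {N : ℕ} (hN : 𝒢.card ≤ N) :
    mass Finset.univ Y ≤ 2 * mass Finset.univ fun i => Y i ∩ {x |
      M < (2 * Fintype.card ι * N : ℕ) *
        volume (shadedUnion Finset.univ Y ∩ gridCube s (gridIndex s x))} := by
  set n := Fintype.card ι with hn
  set u : (Fin 3 → ℤ) → ℝ≥0∞ := fun z => volume (shadedUnion Finset.univ Y ∩ gridCube s z) with hu
  set G : Set E3 := {x | M < (2 * n * N : ℕ) * u (gridIndex s x)} with hG
  have hGm : MeasurableSet G := measurable_gridIndex s (MeasurableSet.of_discrete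
      (s := {z | M < (2 * n * N : ℕ) * u z}))
  have hsplit : mass Finset.univ Y = mass Finset.univ (fun i => Y i ∩ G)
      + mass Finset.univ fun i => Y i \ G := by
    rw [mass, mass, mass, ← Finset.sum_add_distrib]
    exact Finset.sum_congr rfl fun i _ => (measure_inter_add_sdiff _ hGm).symm
  have hbad : 2 * mass Finset.univ (fun i => Y i \ G) ≤ mass Finset.univ Y := by
    refine le_trans ?_ hM
    have h1 : ∀ i, ∀ z ∈ 𝒢, ((2 * n * N : ℕ) : ℝ≥0∞) * volume ((Y i \ G) ∩ gridCube s z) ≤ M := by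
      intro i z _
      by_cases h0 : M < (2 * n * N : ℕ) * u z
      · have : (Y i \ G) ∩ gridCube s z = ∅ := by
          rw [Set.eq_empty_iff_forall_notMem]
          rintro x ⟨⟨-, hx⟩, hxz⟩
          apply hx
          change M < (2 * n * N : ℕ) * u (gridIndex s x)
          rwa [show gridIndex s x = z from hxz]
        rw [this]; simp
      · refine le_trans ?_ (not_lt.1 h0)
        refine mul_le_mul' le_rfl (measure_mono (Set.inter_subset_inter_left _
          fun x (hx : x ∈ Y i \ G) => mem_shadedUnion.2 ⟨i, Finset.mem_univ i, hx.1⟩))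
    rcases Nat.eq_zero_or_pos (n * N) with h0 | h0
    · -- no cubes, or no sets
      have : mass Finset.univ (fun i => Y i \ G) = 0 := by
        refine Finset.sum_eq_zero fun i _ => ?_
        rcases Nat.mul_eq_zero.1 h0 with h0 | h0
        · exact ((Fintype.card_eq_zero_iff.1 h0).false i).elim
        · have : 𝒢 = ∅ := Finset.card_eq_zero.1 (by omega)
          have h3 : Y i \ G = ∅ := Set.eq_empty_iff_forall_notMem.2 fun x hx => by
            have h4 := h𝒢 i x hx.1
            rw [this] at h4
            exact absurd h4 (Finset.notMem_empty _)
          simp only [h3, measure_empty]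
      rw [this]; simp
    · have h2 : ((n * N : ℕ) : ℝ≥0∞) * (2 * mass Finset.univ (fun i => Y i \ G))
          ≤ (n * N : ℕ) * M := by
        calc ((n * N : ℕ) : ℝ≥0∞) * (2 * mass Finset.univ (fun i => Y i \ G))
            = ∑ i, ∑ z ∈ 𝒢, ((2 * n * N : ℕ) : ℝ≥0∞) * volume ((Y i \ G) ∩ gridCube s z) := by
              rw [mass, ← mul_assoc, Finset.mul_sum]
              refine Finset.sum_congr rfl fun i _ => ?_
              rw [← Finset.mul_sum, sum_volume_inter_gridCube_of_subset
                (fun x hx => h𝒢 i x hx.1)]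
              push_cast; ring
          _ ≤ ∑ _i : ι, ∑ _z ∈ 𝒢, M :=
              Finset.sum_le_sum fun i _ => Finset.sum_le_sum fun z hz => h1 i z hz
          _ = (n * 𝒢.card : ℕ) * M := by
              simp only [Finset.sum_const, nsmul_eq_mul, Finset.card_univ, ← hn]
              push_cast; ring
          _ ≤ _ := by gcongr
      rwa [ENNReal.mul_le_mul_iff_right (by exact_mod_cast h0.ne')
        (ENNReal.natCast_ne_top _)] at h2
  have hb : mass Finset.univ (fun i => Y i \ G) ≤ mass Finset.univ fun i => Y i ∩ G := by
    rw [hsplit, two_mul] at hbad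
    refine (ENNReal.add_le_add_iff_right ?_).1 hbad
    exact ne_top_of_le_ne_top hfin
      (Finset.sum_le_sum fun i _ => measure_mono Set.sdiff_subset)
  rw [hsplit, two_mul]
  gcongr

/-- Dyadic pigeonholing of the cubes of the grid: on the chosen cubes, the number of parts and the
volume of the shaded union are constant up to the factor `2`. -/
lemma exists_uniform_cubes (p : ι → κ) {Y : ι → Set E3} {s : ℝ} (hfin : mass Finset.univ Y ≠ ∞)
    {𝒢 : Finset (Fin 3 → ℤ)} (h𝒢 : ∀ i, ∀ x ∈ Y i, gridIndex s x ∈ 𝒢) {N : ℕ} (hN : 𝒢.card ≤ N) :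
    ∃ (𝒜 : Set (Fin 3 → ℤ)) (m : ℕ) (t : ℝ≥0∞),
      (∀ z ∈ 𝒜, (shadedUnion Finset.univ Y ∩ gridCube s z).Nonempty →
        (m ≤ (partsMeeting p Y s z).card ∧ (partsMeeting p Y s z).card ≤ 2 * m) ∧
        (t ≤ volume (shadedUnion Finset.univ Y ∩ gridCube s z) ∧
          volume (shadedUnion Finset.univ Y ∩ gridCube s z) ≤ 2 * t)) ∧
      mass Finset.univ Y ≤ (2 * (Nat.log 2 (2 * Fintype.card ι * N) + 1)
          * (Nat.log 2 (Fintype.card ι) + 1) : ℕ) *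
        mass Finset.univ fun i => Y i ∩ {x | gridIndex s x ∈ 𝒜} := by
  set n := Fintype.card ι with hn
  set u : (Fin 3 → ℤ) → ℝ≥0∞ := fun z => volume (shadedUnion Finset.univ Y ∩ gridCube s z) with hu
  set M : ℝ≥0∞ := 𝒢.sup u with hM
  have hule : ∀ z, u z ≤ mass Finset.univ Y := fun z =>
    (measure_mono Set.inter_subset_left).trans (volume_shadedUnion_le_mass _ _)
  have hMle : M ≤ mass Finset.univ Y := Finset.sup_le fun z _ => hule z
  have hMfin : M ≠ ∞ := ne_top_of_le_ne_top hfin hMle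
  have h1 := mass_le_two_mul_mass_good hfin h𝒢 hMle hN
  set L := 2 * n * N with hL
  set q : (Fin 3 → ℤ) → ℕ := fun z => ⌊M.toReal / (u z).toReal⌋₊ with hq
  set Y₁ : ι → Set E3 := fun i => Y i ∩ {x | M < (L : ℝ≥0∞) * u (gridIndex s x)} with hY₁
  have hgood : ∀ z ∈ 𝒢, M < (L : ℝ≥0∞) * u z →
      1 ≤ M.toReal / (u z).toReal ∧ M.toReal / (u z).toReal ≤ L ∧ 0 < (u z).toReal := by
    intro z hz h
    have hufin : u z ≠ ∞ := ne_top_of_le_ne_top hfin (hule z)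
    have hu0 : u z ≠ 0 := by
      intro h0; rw [h0, mul_zero] at h; exact not_lt_zero h
    have hupos : 0 < (u z).toReal := ENNReal.toReal_pos hu0 hufin
    have h2 : M.toReal ≤ L * (u z).toReal := by
      have := ENNReal.toReal_mono (ENNReal.mul_ne_top (ENNReal.natCast_ne_top _) hufin) h.le
      simpa [ENNReal.toReal_mul] using this
    have h3 : (u z).toReal ≤ M.toReal := ENNReal.toReal_mono hMfin (Finset.le_sup (f := u) hz)
    refine ⟨?_, ?_, hupos⟩
    · rwa [le_div_iff₀ hupos, one_mul]
    · rwa [div_le_iff₀ hupos]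
  obtain ⟨c, -, hc⟩ := exists_mass_le_mul_mass_class Finset.univ Y₁
    (fun _ x => Nat.log 2 (q (gridIndex s x))) (n := Nat.log 2 L + 1) (Nat.succ_pos _)
    (fun i _ x hx => natLog_lt (by
      have := (hgood _ (h𝒢 i x hx.1) hx.2).2.1
      exact (Nat.floor_mono this).trans (by rw [Nat.floor_natCast])))
  set Y₂ : ι → Set E3 := fun i => Y₁ i ∩ {x | Nat.log 2 (q (gridIndex s x)) = c} with hY₂
  obtain ⟨d, -, hd⟩ := exists_mass_le_mul_mass_class Finset.univ Y₂
    (fun _ x => Nat.log 2 (partsMeeting p Y s (gridIndex s x)).card) (n := Nat.log 2 n + 1)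
    (Nat.succ_pos _) (fun i _ x _ => natLog_lt (card_partsMeeting_le _ _ _ _))
  refine ⟨{z | (M < (L : ℝ≥0∞) * u z ∧ Nat.log 2 (q z) = c) ∧
    Nat.log 2 (partsMeeting p Y s z).card = d}, 2 ^ d,
    ENNReal.ofReal (M.toReal / 2 ^ (c + 1)), ?_, ?_⟩
  · rintro z ⟨⟨hz1, hz2⟩, hz3⟩ ⟨x, hx, hxz⟩
    obtain ⟨i, -, hxi⟩ := mem_shadedUnion.1 hx
    have hz𝒢 : z ∈ 𝒢 := by
      have := h𝒢 i x hxi; rwa [show gridIndex s x = z from hxz] at this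
    obtain ⟨hg1, -, hupos⟩ := hgood z hz𝒢 hz1
    have hufin : u z ≠ ∞ := ne_top_of_le_ne_top hfin (hule z)
    have hq0 : q z ≠ 0 := by
      have : 1 ≤ q z := Nat.le_floor (by exact_mod_cast hg1)
      omega
    rw [Nat.log_eq_iff (Or.inr ⟨one_lt_two, hq0⟩)] at hz2
    have hlow : (2 : ℝ) ^ c ≤ M.toReal / (u z).toReal := by
      have h2 : ((2 ^ c : ℕ) : ℝ) ≤ q z := by exact_mod_cast hz2.1
      push_cast at h2
      exact h2.trans (Nat.floor_le (by linarith))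
    have hhigh : M.toReal / (u z).toReal < 2 ^ (c + 1) := by
      have h2 := Nat.lt_floor_add_one (M.toReal / (u z).toReal)
      have h3 : ((q z + 1 : ℕ) : ℝ) ≤ ((2 ^ (c + 1) : ℕ) : ℝ) := by exact_mod_cast hz2.2
      push_cast at h3
      exact h2.trans_le h3
    rw [le_div_iff₀ hupos] at hlow
    rw [div_lt_iff₀ hupos] at hhigh
    refine ⟨natLog_bounds hz3 (Finset.card_ne_zero.2 ⟨p i, mem_partsMeeting.2
      ⟨x, mem_partUnion.2 ⟨i, rfl, hxi⟩, hxz⟩⟩), ?_, ?_⟩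
    · change _ ≤ u z
      rw [← ENNReal.ofReal_toReal hufin]
      apply ENNReal.ofReal_le_ofReal
      rw [div_le_iff₀ (by positivity)]; linarith
    · change u z ≤ _
      rw [← ENNReal.ofReal_toReal hufin, ← ENNReal.ofReal_ofNat 2,
        ← ENNReal.ofReal_mul (by norm_num)]
      apply ENNReal.ofReal_le_ofReal
      have : 2 * (M.toReal / 2 ^ (c + 1)) = M.toReal / 2 ^ c := by
        rw [pow_succ]; field_simp
      rw [this, le_div_iff₀ (by positivity)]; linarith
  · calc mass Finset.univ Y ≤ 2 * mass Finset.univ Y₁ := h1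
      _ ≤ 2 * ((Nat.log 2 L + 1 : ℕ) * ((Nat.log 2 n + 1 : ℕ) * mass Finset.univ fun i =>
          Y₂ i ∩ {x | Nat.log 2 (partsMeeting p Y s (gridIndex s x)).card = d})) := by
        gcongr
        refine hc.trans ?_
        gcongr
      _ = _ := by
        rw [← mul_assoc, ← mul_assoc]
        push_cast
        congr 1
        refine congrArg _ (funext fun i => ?_)
        ext x
        simp only [hY₂, hY₁, Set.mem_inter_iff, Set.mem_ofPred_eq, and_assoc]

end Refinement

/-! ### The uniform refinement, and the estimate for one part -/

lemma HasConstantMultiplicity.mono {ι : Type*} {S : Finset ι} {Y : ι → Set E3} {K K' m : ℕ}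
    (h : HasConstantMultiplicity K m S Y) (hK : K ≤ K') : HasConstantMultiplicity K' m S Y :=
  fun x hx => ⟨(h x hx).1, (h x hx).2.trans (Nat.mul_le_mul_right m hK)⟩

section Refinement

variable {ι κ : Type*} [Fintype ι] [Fintype κ]

/-- All the pigeonholings together. Here `𝒬 j` is the set of the cubes met by the shading of the
part `j`, `a` is the number of members of a part, `m` the number of parts that meet a cube, `m'` the
multiplicity within a part, and `t` the volume of the shaded union in a cube. -/
lemma exists_uniform_refinement (p : ι → κ) {Y : ι → Set E3} (hY : ∀ i, MeasurableSet (Y i))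
    {s : ℝ} (hfin : mass Finset.univ Y ≠ ∞)
    {𝒢 : Finset (Fin 3 → ℤ)} (h𝒢 : ∀ i, ∀ x ∈ Y i, gridIndex s x ∈ 𝒢) {N : ℕ} (hN : 𝒢.card ≤ N) :
    ∃ (Y' : ι → Set E3) (𝒬 : κ → Finset (Fin 3 → ℤ)) (a m m' : ℕ) (t : ℝ≥0∞),
      (∀ i, MeasurableSet (Y' i)) ∧ (∀ i, Y' i ⊆ Y i) ∧
      (∀ i, ∀ x ∈ Y' i, gridIndex s x ∈ 𝒬 (p i)) ∧
      (∀ j, ∀ z ∈ 𝒬 j, volume (partUnion p Y' j ∩ gridCube s z) ≠ 0) ∧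
      (∀ j, (𝒬 j).Nonempty → a ≤ (part Finset.univ p j).card ∧
        (part Finset.univ p j).card ≤ 2 * a) ∧
      (∀ j, HasConstantMultiplicity 2 m' (part Finset.univ p j) Y') ∧
      (∀ j₀, ∀ z ∈ 𝒬 j₀, (m ≤ (Finset.univ.filter fun j => z ∈ 𝒬 j).card ∧
        (Finset.univ.filter fun j => z ∈ 𝒬 j).card ≤ 2 * m) ∧
        (t ≤ volume (shadedUnion Finset.univ Y' ∩ gridCube s z) ∧
        volume (shadedUnion Finset.univ Y' ∩ gridCube s z) ≤ 2 * t)) ∧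
      mass Finset.univ Y ≤ ((Nat.log 2 (Fintype.card ι) + 1) ^ 2 *
        (2 * (Nat.log 2 (2 * Fintype.card ι * N) + 1) * (Nat.log 2 (Fintype.card ι) + 1)) : ℕ) *
          mass Finset.univ Y' := by
  classical
  obtain ⟨Y₁, a, m', hY₁m, hY₁Y, hcard, hmult, hmass₁⟩ := exists_uniform_parts p hY
  have h𝒢₁ : ∀ i, ∀ x ∈ Y₁ i, gridIndex s x ∈ 𝒢 := fun i x hx => h𝒢 i x (hY₁Y i hx)
  obtain ⟨Z, hZm, hnull, hmass₂⟩ := exists_no_null_pieces p s h𝒢₁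
  set Y₂ : ι → Set E3 := fun i => Y₁ i ∩ Z (p i) with hY₂
  have hfin₂ : mass Finset.univ Y₂ ≠ ∞ := by
    rw [hmass₂]
    exact ne_top_of_le_ne_top hfin (Finset.sum_le_sum fun i _ => measure_mono (hY₁Y i))
  have h𝒢₂ : ∀ i, ∀ x ∈ Y₂ i, gridIndex s x ∈ 𝒢 := fun i x hx => h𝒢₁ i x hx.1
  obtain ⟨𝒜, m, t, h𝒜, hmass₃⟩ := exists_uniform_cubes p hfin₂ h𝒢₂ hN
  set B : Set E3 := {x | gridIndex s x ∈ 𝒜} with hB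
  have hBm : MeasurableSet B := measurable_gridIndex s (MeasurableSet.of_discrete (s := 𝒜))
  set Y' : ι → Set E3 := fun i => Y₂ i ∩ B with hY'
  set 𝒬 : κ → Finset (Fin 3 → ℤ) := fun j =>
    𝒢.filter fun z => z ∈ 𝒜 ∧ (partUnion p Y₂ j ∩ gridCube s z).Nonempty with h𝒬
  have hmem𝒬 : ∀ j z, z ∈ 𝒬 j ↔ z ∈ 𝒜 ∧ (partUnion p Y₂ j ∩ gridCube s z).Nonempty := by
    intro j z
    rw [h𝒬, Finset.mem_filter, and_iff_right_iff_imp]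
    rintro ⟨-, x, hx, hxz⟩
    obtain ⟨i, -, hxi⟩ := mem_partUnion.1 hx
    have := h𝒢₂ i x hxi
    rwa [show gridIndex s x = z from hxz] at this
  have hpu : ∀ j, ∀ z ∈ 𝒜, partUnion p Y' j ∩ gridCube s z = partUnion p Y₂ j ∩ gridCube s z := by
    intro j z hz
    ext x
    simp only [Set.mem_inter_iff, mem_partUnion, hY']
    constructor
    · rintro ⟨⟨i, h1, h2, -⟩, h3⟩; exact ⟨⟨i, h1, h2⟩, h3⟩
    · rintro ⟨⟨i, h1, h2⟩, h3⟩
      refine ⟨⟨i, h1, h2, ?_⟩, h3⟩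
      change gridIndex s x ∈ 𝒜
      rwa [show gridIndex s x = z from h3]
  have hsu : ∀ z ∈ 𝒜, shadedUnion Finset.univ Y' ∩ gridCube s z
      = shadedUnion Finset.univ Y₂ ∩ gridCube s z := by
    intro z hz
    ext x
    simp only [Set.mem_inter_iff, mem_shadedUnion, hY']
    constructor
    · rintro ⟨⟨i, h1, h2, -⟩, h3⟩; exact ⟨⟨i, h1, h2⟩, h3⟩
    · rintro ⟨⟨i, h1, h2⟩, h3⟩
      refine ⟨⟨i, h1, h2, ?_⟩, h3⟩
      change gridIndex s x ∈ 𝒜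
      rwa [show gridIndex s x = z from h3]
  refine ⟨Y', 𝒬, a, m, m', t, fun i => ((hY₁m i).inter (hZm _)).inter hBm,
    fun i x hx => hY₁Y i hx.1.1, fun i x hx => (hmem𝒬 _ _).2 ⟨hx.2, x,
      mem_partUnion.2 ⟨i, rfl, hx.1⟩, rfl⟩, ?_, ?_, ?_, ?_, ?_⟩
  · intro j z hz
    obtain ⟨hz1, hz2⟩ := (hmem𝒬 j z).1 hz
    rw [hpu j z hz1]
    exact hnull j z hz2
  · rintro j ⟨z, hz⟩
    obtain ⟨-, x, hx, -⟩ := (hmem𝒬 j z).1 hz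
    obtain ⟨i, rfl, hxi⟩ := mem_partUnion.1 hx
    exact hcard i ⟨x, hxi.1⟩
  · intro j
    exact ((hmult j).inter Z).inter fun _ => B
  · intro j₀ z hz
    obtain ⟨hz1, x, hx, hxz⟩ := (hmem𝒬 j₀ z).1 hz
    obtain ⟨i, -, hxi⟩ := mem_partUnion.1 hx
    have h1 := h𝒜 z hz1 ⟨x, mem_shadedUnion.2 ⟨i, Finset.mem_univ i, hxi⟩, hxz⟩
    have h2 : (Finset.univ.filter fun j => z ∈ 𝒬 j) = partsMeeting p Y₂ s z := by
      ext j
      rw [Finset.mem_filter, hmem𝒬, mem_partsMeeting]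
      simp [hz1]
    rw [h2, hsu z hz1]
    exact h1
  · refine hmass₁.trans ?_
    rw [Nat.cast_mul, mul_assoc, ← hmass₂]
    gcongr

end Refinement

section Frostman

variable {ι : Type*}

open Classical in
lemma setDensity_eq {S : Finset ι} {V : ι → Set E3} {W : Set E3} (h : ∀ i ∈ S, V i ⊆ W) :
    setDensity S V W = mass S V / volume W := by
  rw [setDensity, Finset.filter_true_of_mem h, mass]

open Classical in
lemma sum_volume_le_of_frostman {S : Finset ι} {V : ι → Set E3} {W : Set E3} {C : ℝ≥0}
    (hC : frostmanConstant S V W ≤ C) (hV : ∀ i ∈ S, V i ⊆ W)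
    (hV0 : ∀ i ∈ S, volume (V i) ≠ 0) (hVt : ∀ i ∈ S, volume (V i) ≠ ∞)
    (hW0 : volume W ≠ 0) (hWt : volume W ≠ ∞) (hS : S.Nonempty)
    {K : Set E3} (hK : Convex ℝ K) (hKW : K ⊆ W) :
    ∑ i ∈ S with V i ⊆ K, volume (V i) ≤ (C * (mass S V / volume W)) * volume K := by
  obtain ⟨i₀, hi₀⟩ := hS
  have hm0 : mass S V ≠ 0 := fun h => hV0 i₀ hi₀ (Finset.sum_eq_zero_iff.1 h i₀ hi₀)
  have hmt : mass S V ≠ ∞ := ENNReal.sum_ne_top.2 hVt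
  have hF0 : mass S V / volume W ≠ 0 := ENNReal.div_ne_zero.2 ⟨hm0, hWt⟩
  have hFt : mass S V / volume W ≠ ∞ := ENNReal.div_ne_top hmt hW0
  rw [frostmanConstant, setDensity_eq hV, ENNReal.div_le_iff hF0 hFt] at hC
  have h1 : setDensity S V K ≤ C * (mass S V / volume W) :=
    (le_iSup₂ (f := fun K' (_ : Convex ℝ K' ∧ K' ⊆ W) => setDensity S V K') K ⟨hK, hKW⟩).trans hC
  rw [setDensity] at h1
  rcases eq_or_ne (volume K) 0 with hK0 | hK0
  · -- a null set contains no members of the family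
    have : ∑ i ∈ S with V i ⊆ K, volume (V i) = 0 := Finset.sum_eq_zero fun i hi =>
      measure_mono_null (Finset.mem_filter.1 hi).2 hK0
    rw [this]; exact zero_le
  · rwa [ENNReal.div_le_iff hK0 (ne_top_of_le_ne_top hWt (measure_mono hKW))] at h1

/-- A shading of a Frostman family in a slab `W` meets many cubes of the grid: Córdoba's estimate
combined with Cauchy–Schwarz. -/
lemma mass_sq_mul_volume_le {S : Finset ι} {V Y : ι → Set E3} {W : Set E3} {C : ℝ≥0}
    (hC : frostmanConstant S V W ≤ C) (hconv : ∀ i ∈ S, Convex ℝ (V i)) (hW : Convex ℝ W)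
    (hV : ∀ i ∈ S, V i ⊆ W)
    (hV0 : ∀ i ∈ S, volume (V i) ≠ 0) (hVt : ∀ i ∈ S, volume (V i) ≠ ∞)
    (hW0 : volume W ≠ 0) (hWt : volume W ≠ ∞) (hS : S.Nonempty)
    {s A R : ℝ} {k₀ : ℕ} (hs : 0 < s) {n : E3} (hn : ‖n‖ = 1) (hA : 0 ≤ A)
    (hslab : ∀ x ∈ W, ∀ y ∈ W, |inner ℝ n (x - y)| ≤ A * (2 * s))
    (hR : ∀ i ∈ S, ∀ x ∈ V i, ∀ y ∈ V i, dist x y ≤ R)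
    (hk₀ : 4 * R + 2 * s ≤ 2 ^ k₀ * (2 * s))
    {𝒬 : Finset (Fin 3 → ℤ)} (hYV : ∀ i ∈ S, Y i ⊆ V i)
    (h𝒬 : ∀ i ∈ S, ∀ x ∈ Y i, gridIndex s x ∈ 𝒬) :
    mass S Y ^ 2 * volume W ≤ (k₀ + 1) * ENNReal.ofReal (2228224 * A) * C * mass S V ^ 2 *
      volume {x | gridIndex s x ∈ 𝒬} := by
  have h1 := mass_sq_le hs hYV h𝒬
  have h2 := sum_sum_volume_closePairs_le (Φ := C * (mass S V / volume W)) hconv hW hV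
    (by positivity : 0 < 2 * s) hn hslab
    (fun K hK hKW _ => sum_volume_le_of_frostman hC hV hV0 hVt hW0 hWt hS hK hKW) hR hk₀ hV0
  have h3 : ENNReal.ofReal (2228224 * A) * ENNReal.ofReal (s ^ 3)
      = 2 * ENNReal.ofReal (139264 * (A * (2 * s) * (2 * s) ^ 2)) := by
    rw [← ENNReal.ofReal_mul (by positivity), ← ENNReal.ofReal_ofNat 2,
      ← ENNReal.ofReal_mul (by norm_num)]
    congr 1; ring
  calc mass S Y ^ 2 * volume W
      ≤ (𝒬.card * (2 * ((k₀ + 1) * (ENNReal.ofReal (139264 * (A * (2 * s) * (2 * s) ^ 2)) *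
          (C * (mass S V / volume W)) * mass S V)))) * volume W := by
        gcongr
        refine h1.trans ?_
        gcongr
        exact h2
    _ = (k₀ + 1) * (2 * ENNReal.ofReal (139264 * (A * (2 * s) * (2 * s) ^ 2))) * C * mass S V *
          𝒬.card * (mass S V / volume W * volume W) := by ring
    _ = _ := by
        rw [ENNReal.div_mul_cancel hW0 hWt, ← h3, volume_gridIndex_mem hs]
        ring

end Frostman

/-! ### Reference volumes, logarithms, and averages -/

section ReferenceVolume

/-- A lower bound for the volume of all convex sets whose dimensions are `v` up to the factor `A`;
it is sharp up to a factor that depends on `A` only. -/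
noncomputable def refVolume (A : ℝ) (v : Fin 3 → ℝ) : ℝ≥0∞ :=
  ENNReal.ofReal ((∏ k, v k / 2) / (1000 * A ^ 3)) * volume (Metric.ball (0 : E3) 1)

variable {V : Set E3} {v d : Fin 3 → ℝ} {A : ℝ}

lemma ApproxDimensions.pos (hA : 1 ≤ A) (hd : ∀ k, 0 < d k) (h : ApproxDimensions A v d)
    (k : Fin 3) : 0 < v k := by
  have h1 := (hd k).trans_le (h k).2
  exact pos_of_mul_pos_right h1 (by linarith)

lemma refVolume_ne_zero (hA : 1 ≤ A) (hv : ∀ k, 0 < v k) : refVolume A v ≠ 0 := by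
  have : 0 < ∏ k, v k / 2 := Finset.prod_pos fun k _ => half_pos (hv k)
  exact (ENNReal.mul_pos (ENNReal.ofReal_pos.2 (by positivity)).ne'
    (Metric.measure_ball_pos _ _ one_pos).ne').ne'

lemma refVolume_ne_top : refVolume A v ≠ ∞ :=
  ENNReal.mul_ne_top ENNReal.ofReal_ne_top measure_ball_lt_top.ne

lemma ofReal_mul_refVolume {x : ℝ} (hx : 0 ≤ x) :
    ENNReal.ofReal x * refVolume A v
      = ENNReal.ofReal (x * ((∏ k, v k / 2) / (1000 * A ^ 3))) *
        volume (Metric.ball (0 : E3) 1) := by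
  rw [refVolume, ← mul_assoc, ← ENNReal.ofReal_mul hx]

lemma prod_le_of_approxDimensions (hA : 1 ≤ A) (hd : ∀ k, 0 < d k) (h : ApproxDimensions A v d) :
    (∏ k, v k / 2) / A ^ 3 ≤ ∏ k, d k / 2 ∧ ∏ k, d k / 2 ≤ A ^ 3 * ∏ k, v k / 2 := by
  have hv := h.pos hA hd
  have hA0 : 0 < A := by linarith
  have e1 : (∏ k, v k / 2) / A ^ 3 = ∏ k, v k / A / 2 := by
    simp only [Fin.prod_univ_three]; field_simp
  have e2 : A ^ 3 * ∏ k, v k / 2 = ∏ k, A * v k / 2 := by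
    simp only [Fin.prod_univ_three]; ring
  rw [e1, e2]
  constructor
  · refine Finset.prod_le_prod (fun k _ => ?_) fun k _ => ?_
    · have := hv k; positivity
    · linarith [(h k).1]
  · refine Finset.prod_le_prod (fun k _ => (half_pos (hd k)).le) fun k _ => ?_
    linarith [(h k).2]

lemma HasDimensions.refVolume_le (h : HasDimensions V d) (hconv : Convex ℝ V) (hA : 1 ≤ A)
    (hap : ApproxDimensions A v d) : refVolume A v ≤ volume V := by
  refine le_trans ?_ (h.le_volume hconv)
  rw [refVolume]
  gcongr
  have h1 := (prod_le_of_approxDimensions hA h.1 hap).1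
  have hA0 : 0 < A := by linarith
  rw [div_le_iff₀ (by positivity)] at h1 ⊢
  linarith

lemma HasDimensions.volume_le_refVolume (h : HasDimensions V d) (hA : 1 ≤ A)
    (hap : ApproxDimensions A v d) :
    volume V ≤ ENNReal.ofReal (1000 * A ^ 6) * refVolume A v := by
  have hA0 : 0 < A := by linarith
  rw [ofReal_mul_refVolume (by positivity)]
  refine h.volume_le.trans ?_
  gcongr
  refine (prod_le_of_approxDimensions hA h.1 hap).2.trans (le_of_eq ?_)
  field_simp

lemma HasDimensions.volume_thickening_le_refVolume (h : HasDimensions V d) (hA : 1 ≤ A)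
    (hap : ApproxDimensions A v d) : volume (Metric.thickening (v 0) V)
      ≤ ENNReal.ofReal (27000 * A ^ 9) * refVolume A v := by
  have hA0 : 0 < A := by linarith
  have hv := hap.pos hA h.1
  rw [ofReal_mul_refVolume (by positivity)]
  refine (h.volume_thickening_le (hv 0).le).trans
    (mul_le_mul' (ENNReal.ofReal_le_ofReal ?_) le_rfl)
  have h1 := (prod_le_of_approxDimensions hA h.1 hap).2
  have h2 : 1 + 2 * v 0 / d 0 ≤ 3 * A := by
    have h3 := (hap 0).1
    rw [div_le_iff₀ hA0] at h3
    have h4 : 2 * v 0 / d 0 ≤ 2 * A := by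
      rw [div_le_iff₀ (h.1 0)]; linarith
    linarith
  have h3 : 0 ≤ 2 * v 0 / d 0 := div_nonneg (by linarith [hv 0]) (h.1 0).le
  have h4 : 0 < ∏ k, v k / 2 := Finset.prod_pos fun k _ => half_pos (hv k)
  calc (1 + 2 * v 0 / d 0) ^ 3 * ∏ k, d k / 2 ≤ (3 * A) ^ 3 * (A ^ 3 * ∏ k, v k / 2) := by
        gcongr
        exact Finset.prod_nonneg fun k _ => (half_pos (h.1 k)).le
    _ = _ := by field_simp; ring

end ReferenceVolume

section Logarithms

/-- A bound for the number of classes in each dyadic pigeonholing. -/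
noncomputable def logLoss (A ρ : ℝ) : ℝ := 5 * Real.logb 2 (100 * A / ρ) + 2

lemma natLog_add_two_le_logLoss {A ρ : ℝ} (hA : 1 ≤ A) (hρ : 0 < ρ) (hρ1 : ρ ≤ 1) {a : ℕ}
    (ha : (a : ℝ) ≤ (100 * A / ρ) ^ 5) : (Nat.log 2 a : ℝ) + 2 ≤ logLoss A ρ := by
  have hX : 1 ≤ 100 * A / ρ := by rw [le_div_iff₀ hρ]; linarith
  have h0 : 0 ≤ Real.logb 2 (100 * A / ρ) := Real.logb_nonneg one_lt_two hX
  unfold logLoss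
  rcases Nat.eq_zero_or_pos a with rfl | ha0
  · simp; linarith
  have h1 : (Nat.log 2 a : ℝ) ≤ Real.logb 2 a := by
    have := Real.natLog_le_logb a 2
    exact_mod_cast this
  have h2 : Real.logb 2 a ≤ Real.logb 2 ((100 * A / ρ) ^ 5) :=
    Real.logb_le_logb_of_le one_lt_two (by exact_mod_cast ha0) ha
  rw [Real.logb_pow] at h2
  push_cast at h2
  linarith

lemma two_le_logLoss {A ρ : ℝ} (hA : 1 ≤ A) (hρ : 0 < ρ) (hρ1 : ρ ≤ 1) : 2 ≤ logLoss A ρ := by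
  have := natLog_add_two_le_logLoss hA hρ hρ1 (a := 0) (by simp; positivity)
  simpa using this

/-- Powers of logarithms of `1 / ρ` are absorbed by `ρ ^ (-ε)`. -/
lemma exists_logLoss_le_rpow {A : ℝ} (hA : 1 ≤ A) {c : ℝ} (hc : 0 ≤ c) :
    ∃ K : ℝ → ℝ, ∀ ρ : ℝ, 0 < ρ → ρ ≤ 1 → ∀ ε : ℝ, 0 < ε →
      c * logLoss A ρ ^ 9 ≤ K ε * ρ ^ (-ε) := by
  set c₀ : ℝ := 5 * (Real.log (100 * A) / Real.log 2) + 2 with hc₀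
  set c₁ : ℝ := 5 / Real.log 2 with hc₁
  have hlog2 : 0 < Real.log 2 := Real.log_pos one_lt_two
  have hc₀0 : 0 ≤ c₀ := by
    have : 0 ≤ Real.log (100 * A) := Real.log_nonneg (by linarith)
    positivity
  refine ⟨fun ε => c * (c₀ + c₁ * (9 / ε)) ^ 9, fun ρ hρ hρ1 ε hε => ?_⟩
  have hδ : 0 < ε / 9 := by positivity
  have h1 : Real.log ρ⁻¹ ≤ (ρ⁻¹) ^ (ε / 9) / (ε / 9) :=
    Real.log_le_rpow_div (inv_nonneg.2 hρ.le) hδ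
  set y := (ρ⁻¹) ^ (ε / 9) with hy
  have hy1 : 1 ≤ y := Real.one_le_rpow ((one_le_inv₀ hρ).2 hρ1) hδ.le
  have h2 : logLoss A ρ ≤ (c₀ + c₁ * (9 / ε)) * y := by
    have e1 : logLoss A ρ = c₀ + c₁ * Real.log ρ⁻¹ := by
      rw [logLoss, Real.logb, div_eq_mul_inv (100 * A), Real.log_mul (by linarith)
        (inv_ne_zero hρ.ne'), hc₀, hc₁]
      ring
    rw [e1, add_mul]
    have h3 : c₁ * Real.log ρ⁻¹ ≤ c₁ * (9 / ε) * y := by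
      rw [mul_assoc]
      gcongr
      refine h1.trans (le_of_eq ?_)
      field_simp
    nlinarith
  have h3 : 0 ≤ logLoss A ρ := by linarith [two_le_logLoss hA hρ hρ1]
  have h4 : y ^ 9 = ρ ^ (-ε) := by
    rw [hy, ← Real.rpow_natCast, ← Real.rpow_mul (inv_nonneg.2 hρ.le), Real.inv_rpow hρ.le,
      ← Real.rpow_neg hρ.le]
    congr 1; push_cast; ring
  calc c * logLoss A ρ ^ 9 ≤ c * ((c₀ + c₁ * (9 / ε)) * y) ^ 9 := by gcongr
    _ = c * (c₀ + c₁ * (9 / ε)) ^ 9 * ρ ^ (-ε) := by rw [mul_pow, h4, mul_assoc]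

end Logarithms

/-- The Cauchy–Schwarz step that passes from an estimate for each `W` to the averages over all `W`:
`M j`, `y j` and `h j` are the masses of the shading in `𝕍_W` and of the shading of `W`, and the
volume of the neighbourhood of `W`. -/
lemma inv_mul_sq_le_of_forall {κ : Type*} {S : Finset κ} {M y h : κ → ℝ≥0∞}
    {L C Λ B B' τ ω T X : ℝ≥0∞} (hS : S.Nonempty)
    (hM : ∀ j ∈ S, M j ^ 2 * ω ≤ Λ * C * (B * τ) ^ 2 * y j)
    (hX : X ≤ L * ∑ j ∈ S, M j) (hT : S.card * τ ≤ T) (hτ0 : τ ≠ 0) (hτt : τ ≠ ∞)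
    (hh : ∀ j ∈ S, h j ≤ B' * ω) (hh0 : ∑ j ∈ S, h j ≠ 0) (hht : ∑ j ∈ S, h j ≠ ∞) :
    C⁻¹ * (X / T) ^ 2 ≤ L ^ 2 * Λ * B ^ 2 * B' * ((∑ j ∈ S, y j) / ∑ j ∈ S, h j) := by
  set D := X / T with hD
  have hcard0 : (S.card : ℝ≥0∞) ≠ 0 := by exact_mod_cast hS.card_pos.ne'
  have h1 : D * (S.card * τ) ≤ L * ∑ j ∈ S, M j := by
    refine le_trans ?_ hX
    calc D * (S.card * τ) ≤ D * T := by gcongr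
      _ = T * (X / T) := mul_comm _ _
      _ ≤ X := ENNReal.mul_div_le
  have h2 : (S.card * τ ^ 2) * (D ^ 2 * (S.card * ω))
      ≤ (S.card * τ ^ 2) * (L ^ 2 * Λ * B ^ 2 * C * ∑ j ∈ S, y j) := by
    calc (S.card * τ ^ 2) * (D ^ 2 * (S.card * ω)) = (D * (S.card * τ)) ^ 2 * ω := by ring
      _ ≤ (L * ∑ j ∈ S, M j) ^ 2 * ω := by gcongr
      _ = L ^ 2 * (∑ j ∈ S, M j) ^ 2 * ω := by ring
      _ ≤ L ^ 2 * (S.card * ∑ j ∈ S, M j ^ 2) * ω := by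
          gcongr; exact ENNReal.sum_sq_le_card_mul _ _
      _ = L ^ 2 * S.card * ∑ j ∈ S, M j ^ 2 * ω := by rw [← Finset.sum_mul]; ring
      _ ≤ L ^ 2 * S.card * ∑ j ∈ S, Λ * C * (B * τ) ^ 2 * y j := by
          exact mul_le_mul' le_rfl (Finset.sum_le_sum hM)
      _ = _ := by rw [← Finset.mul_sum]; ring
  rw [ENNReal.mul_le_mul_iff_right (mul_ne_zero hcard0 (pow_ne_zero 2 hτ0))
    (ENNReal.mul_ne_top (ENNReal.natCast_ne_top _) (ENNReal.pow_ne_top hτt))] at h2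
  rw [← mul_div_assoc, ENNReal.le_div_iff_mul_le (Or.inl hh0) (Or.inl hht)]
  calc C⁻¹ * D ^ 2 * ∑ j ∈ S, h j ≤ C⁻¹ * D ^ 2 * ∑ _j ∈ S, B' * ω := by
        gcongr with j hj; exact hh j hj
    _ = C⁻¹ * B' * (D ^ 2 * (S.card * ω)) := by
        rw [Finset.sum_const, nsmul_eq_mul]; ring
    _ ≤ C⁻¹ * B' * (L ^ 2 * Λ * B ^ 2 * C * ∑ j ∈ S, y j) := by gcongr
    _ = (C⁻¹ * C) * (L ^ 2 * Λ * B ^ 2 * B' * ∑ j ∈ S, y j) := by ring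
    _ ≤ 1 * (L ^ 2 * Λ * B ^ 2 * B' * ∑ j ∈ S, y j) := by
        gcongr; exact ENNReal.inv_mul_le_one C
    _ = _ := one_mul _

/-! ### The refinement of a shading of positive mass -/

/-- A finite family of sets of diameter less than `M * s` meets few cubes of the grid of side `s`. -/
lemma exists_finset_gridIndex {ι : Type*} [Fintype ι] {V : ι → Set E3} {s : ℝ} (hs : 0 < s)
    {M : ℕ} (hM : ∀ i, ∀ x ∈ V i, ∀ y ∈ V i, dist x y < M * s) :
    ∃ 𝒢 : Finset (Fin 3 → ℤ), 𝒢.card ≤ Fintype.card ι * (2 * M + 1) ^ 3 ∧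
      ∀ i, ∀ x ∈ V i, gridIndex s x ∈ 𝒢 := by
  classical
  have h : ∀ i, ∃ 𝒢 : Finset (Fin 3 → ℤ), 𝒢.card ≤ (2 * M + 1) ^ 3 ∧
      ∀ x ∈ V i, gridIndex s x ∈ 𝒢 := by
    intro i
    rcases (V i).eq_empty_or_nonempty with h0 | ⟨x, hx⟩
    · exact ⟨∅, by simp, by simp [h0]⟩
    · exact ⟨_, (card_piFinset_Icc (gridIndex s x) M).le,
        fun y hy => gridIndex_mem_piFinset hs (hM i y hy x hx)⟩
  choose 𝒢 h𝒢 hmem using h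
  refine ⟨Finset.univ.biUnion 𝒢, ?_, fun i x hx =>
    Finset.mem_biUnion.2 ⟨i, Finset.mem_univ i, hmem i x hx⟩⟩
  exact (Finset.card_biUnion_le_card_mul _ _ _ fun i _ => h𝒢 i).trans (by rw [Finset.card_univ])

/-- If on every cube that meets a set `U` the volume of `U` is about `t`, then on every ball about a
point of such a cube, of radius twice the side, it is about `t`: the ball contains the cube and
meets at most `125` cubes. -/
lemma volume_inter_ball_le {s : ℝ} (hs : 0 < s) {U : Set E3} {t : ℝ≥0∞}
    {𝒬 : Set (Fin 3 → ℤ)} (hU : ∀ x ∈ U, gridIndex s x ∈ 𝒬)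
    (h1 : ∀ z ∈ 𝒬, t ≤ volume (U ∩ gridCube s z)) (h2 : ∀ z ∈ 𝒬, volume (U ∩ gridCube s z) ≤ 2 * t)
    (x : E3) {y : E3} (hy : gridIndex s y ∈ 𝒬) :
    volume (U ∩ Metric.ball x (2 * s)) ≤ 250 * volume (U ∩ Metric.ball y (2 * s)) := by
  have hlow : t ≤ volume (U ∩ Metric.ball y (2 * s)) := by
    refine (h1 _ hy).trans (measure_mono (Set.inter_subset_inter_right _ fun z hz => ?_))
    exact dist_lt_of_gridIndex_eq hs hz
  have hcube : ∀ z, volume (U ∩ gridCube s z) ≤ 2 * t := by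
    intro z
    by_cases hz : z ∈ 𝒬
    · exact h2 z hz
    · have : U ∩ gridCube s z = ∅ := by
        rw [Set.eq_empty_iff_forall_notMem]
        rintro a ⟨ha, haz⟩
        exact hz (by have := hU a ha; rwa [show gridIndex s a = z from haz] at this)
      rw [this]; simp
  set P := Fintype.piFinset fun k => Finset.Icc (gridIndex s x k - (2 : ℕ)) (gridIndex s x k + (2 : ℕ))
    with hP
  have hcard : P.card = 125 := card_piFinset_Icc (gridIndex s x) 2
  have hmem : ∀ a ∈ U ∩ Metric.ball x (2 * s), gridIndex s a ∈ P := fun a ha =>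
    gridIndex_mem_piFinset hs (M := 2) (by exact_mod_cast ha.2)
  rw [← sum_volume_inter_gridCube_of_subset hmem]
  calc ∑ z ∈ P, volume (U ∩ Metric.ball x (2 * s) ∩ gridCube s z) ≤ ∑ _z ∈ P, 2 * t :=
        Finset.sum_le_sum fun z _ => (measure_mono
          (Set.inter_subset_inter_left _ Set.inter_subset_left)).trans (hcube z)
    _ = 250 * t := by
        rw [Finset.sum_const, hcard, nsmul_eq_mul, ← mul_assoc]; norm_num
    _ ≤ _ := by gcongr

/-- The proposition with all losses collected in one factor, a power of `logLoss A ρ`. -/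
lemma exists_refinement_of_mass_ne_zero {A : ℝ} (hA : 1 ≤ A) {ι κ : Type*} [Fintype ι] [Fintype κ]
    {V : ι → Set E3} {W : κ → Set E3} {p : ι → κ} {Y : ι → Set E3}
    {v w : Fin 3 → ℝ} {C : ℝ≥0} {ρ : ℝ}
    (hVconv : ∀ i, Convex ℝ (V i)) (hWconv : ∀ j, Convex ℝ (W j)) (hVW : ∀ i, V i ⊆ W (p i))
    (hρ : 0 < ρ) (hρι : ρ * Fintype.card ι ≤ 1)
    (hVd : ∀ i, ∃ d, HasDimensions (V i) d ∧ ApproxDimensions A v d ∧ ρ ≤ d 0 / d 2)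
    (hWd : ∀ j, ∃ d, HasDimensions (W j) d ∧ ApproxDimensions A w d)
    (hF : ∀ j, frostmanConstant (part Finset.univ p j) V (W j) ≤ C)
    (hY : IsShading Finset.univ V Y) (hmass : mass Finset.univ Y ≠ 0) :
    ∃ Λ : ℝ≥0∞,
      Λ = ENNReal.ofReal (27000 * 16 * 2228224 * 1000 ^ 2 * A ^ 22 * logLoss A ρ ^ 9) ∧ ρ ≤ 1 ∧
    ∃ (V' : Finset ι) (Y' : ι → Set E3) (W' : Finset κ) (YW : κ → Set E3),
      (∀ i ∈ V', p i ∈ W') ∧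
      IsShading V' V Y' ∧
      IsShading W' (fun j => Metric.thickening (w 0) (W j)) YW ∧
      (∀ j ∈ W', YW j ⊆ Metric.thickening (w 0) (shadedUnion (part V' p j) Y')) ∧
      IsRefinement V' Y' Finset.univ Y ∧
      mass Finset.univ Y ≤ Λ * mass V' Y' ∧
      (C : ℝ≥0∞)⁻¹ * shadingDensity Finset.univ V Y ^ 2
        ≤ Λ * shadingDensity W' (fun j => Metric.thickening (w 0) (W j)) YW ∧
      (∃ m : ℕ, HasConstantMultiplicity 250 m W' YW) ∧
      (∃ m : ℕ, ∀ j ∈ W', HasConstantMultiplicity 250 m (part V' p j) Y') ∧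
      (∀ j ∈ W', avgMultiplicity Finset.univ Y
        ≤ Λ * (avgMultiplicity W' YW * avgMultiplicity (part V' p j) Y')) ∧
      (∀ x ∈ shadedUnion V' Y',
        incident V' Y' x ⊆ ⋃ j ∈ incident W' YW x, incident (part V' p j) Y' x) ∧
      (∀ x ∈ shadedUnion W' YW, ∀ y ∈ shadedUnion W' YW,
        volume (shadedUnion V' Y' ∩ Metric.ball x (w 0)) ≤
          ((250 : ℕ) : ℝ≥0∞) * volume (shadedUnion V' Y' ∩ Metric.ball y (w 0))) := by
  classical
  have hA0 : 0 < A := by linarith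
  choose dV hdV hapV hδV using hVd
  choose dW hdW hapW using hWd
  obtain ⟨i₀⟩ : Nonempty ι := by
    by_contra h
    rw [not_nonempty_iff] at h
    exact hmass (by simp [mass])
  set n := Fintype.card ι with hn
  have hn1 : 1 ≤ n := Fintype.card_pos_iff.2 ⟨i₀⟩
  have hn1' : (1 : ℝ) ≤ n := by exact_mod_cast hn1
  have hρ1 : ρ ≤ 1 := by nlinarith
  have hnρ : (n : ℝ) ≤ 1 / ρ := by rw [le_div_iff₀ hρ]; linarith
  have hv : ∀ k, 0 < v k := (hapV i₀).pos hA (hdV i₀).1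
  have hw : ∀ k, 0 < w k := (hapW (p i₀)).pos hA (hdW (p i₀)).1
  have hV0 : ∀ i, volume (V i) ≠ 0 := fun i => ((hdV i).volume_pos (hVconv i)).ne'
  have hVt : ∀ i, volume (V i) ≠ ∞ := fun i => (hdV i).volume_lt_top.ne
  have hW0 : ∀ j, volume (W j) ≠ 0 := fun j => ((hdW j).volume_pos (hWconv j)).ne'
  have hWt : ∀ j, volume (W j) ≠ ∞ := fun j => (hdW j).volume_lt_top.ne
  -- the scale `w 0`, and the side `s` of the cubes of the grid
  obtain ⟨s, hsw⟩ : ∃ s : ℝ, w 0 = 2 * s := ⟨w 0 / 2, by ring⟩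
  have hs : 0 < s := by have := hw 0; linarith
  rw [hsw]
  have hslab : ∀ j, ∃ e : E3, ‖e‖ = 1 ∧
      ∀ x ∈ W j, ∀ y ∈ W j, |inner ℝ e (x - y)| ≤ A * (2 * s) := by
    intro j
    obtain ⟨e, he, h⟩ := (hdW j).exists_slab
    refine ⟨e, he, fun x hx y hy => (h x hx y hy).trans ?_⟩
    rw [← hsw]; exact (hapW j 0).2
  choose e he heslab using hslab
  -- the members of the family are not much longer than `w 0 / ρ`
  set R : ℝ := 10 * (A * (2 * s)) / ρ with hR
  have hdist : ∀ i, ∀ x ∈ V i, ∀ y ∈ V i, dist x y ≤ R := by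
    intro i x hx y hy
    have h1 := (hdV i).le_of_slab (hVconv i) (he (p i))
      fun x hx y hy => heslab (p i) x (hVW i hx) y (hVW i hy)
    have h2 := hδV i
    rw [le_div_iff₀ ((hdV i).1 2)] at h2
    refine ((hdV i).dist_le hx hy).trans ?_
    rw [hR, le_div_iff₀ hρ]; linarith
  have hAρ : 1 ≤ A / ρ := by rw [le_div_iff₀ hρ]; linarith
  -- the number of cubes
  set M : ℕ := ⌈20 * A / ρ⌉₊ + 1 with hM
  have hMlow : 20 * A / ρ < M := by
    rw [hM]; push_cast; linarith [Nat.le_ceil (20 * A / ρ)]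
  have hMhigh : (M : ℝ) ≤ 22 * (A / ρ) := by
    rw [hM]; push_cast
    have h1 : 20 * A / ρ = 20 * (A / ρ) := by ring
    linarith [Nat.ceil_lt_add_one (show 0 ≤ 20 * A / ρ by positivity)]
  obtain ⟨𝒢, h𝒢card, h𝒢⟩ := exists_finset_gridIndex hs (V := V) (M := M) (by
    intro i x hx y hy
    refine (hdist i x hx y hy).trans_lt ?_
    have : R = 20 * A / ρ * s := by rw [hR]; ring
    rw [this]; gcongr)
  set N := n * (2 * M + 1) ^ 3 with hN
  -- the number of dyadic scales in the `L²` estimate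
  set X : ℕ := ⌈40 * A / ρ⌉₊ + 1 with hX
  have hXlow : 40 * A / ρ + 1 ≤ X := by
    rw [hX]; push_cast; linarith [Nat.le_ceil (40 * A / ρ)]
  have hXhigh : (X : ℝ) ≤ 42 * (A / ρ) := by
    rw [hX]; push_cast
    have h1 : 40 * A / ρ = 40 * (A / ρ) := by ring
    linarith [Nat.ceil_lt_add_one (show 0 ≤ 40 * A / ρ by positivity)]
  set k₀ : ℕ := Nat.log 2 X + 1 with hk₀
  have hk₀R : 4 * R + 2 * s ≤ 2 ^ k₀ * (2 * s) := by
    have h1 : (X : ℝ) < 2 ^ k₀ := by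
      exact_mod_cast Nat.lt_pow_succ_log_self one_lt_two X
    have h2 : 4 * R + 2 * s = (40 * A / ρ + 1) * (2 * s) := by rw [hR]; ring
    rw [h2]
    gcongr
    linarith
  -- all logarithms are at most `ℓ`
  set ℓ := logLoss A ρ with hℓ
  have hℓ2 : 2 ≤ ℓ := two_le_logLoss hA hρ hρ1
  have hpow : (100 * A / ρ) ^ 5 = 10 ^ 10 * (A / ρ) ^ 5 := by ring
  have hn' : (n : ℝ) ≤ A / ρ := hnρ.trans (by gcongr)
  have hlogn : (Nat.log 2 n : ℝ) + 2 ≤ ℓ := by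
    refine natLog_add_two_le_logLoss hA hρ hρ1 ?_
    rw [hpow]
    have := le_self_pow₀ hAρ (by norm_num : 5 ≠ 0)
    linarith
  have hlogX : (Nat.log 2 X : ℝ) + 2 ≤ ℓ := by
    refine natLog_add_two_le_logLoss hA hρ hρ1 ?_
    rw [hpow]
    have := le_self_pow₀ hAρ (by norm_num : 5 ≠ 0)
    linarith
  have hlogN : (Nat.log 2 (2 * n * N) : ℝ) + 2 ≤ ℓ := by
    refine natLog_add_two_le_logLoss hA hρ hρ1 ?_
    rw [hpow, hN]
    push_cast
    calc (2 * n * (n * (2 * M + 1) ^ 3) : ℝ)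
        ≤ 2 * (A / ρ) * ((A / ρ) * (45 * (A / ρ)) ^ 3) := by
          gcongr; linarith
      _ ≤ _ := by
          have : 0 < (A / ρ) ^ 5 := by positivity
          nlinarith
  -- the given shadings are null measurable only, so discard null sets
  have hY0 : ∀ i, ∃ T ⊆ Y i, MeasurableSet T ∧ T =ᵐ[volume] Y i := fun i =>
    (hY i (Finset.mem_univ i)).1.exists_measurable_subset_ae_eq
  choose Y₀ hY₀Y hY₀m hY₀ae using hY0
  have hmassY₀ : mass Finset.univ Y₀ = mass Finset.univ Y :=
    Finset.sum_congr rfl fun i _ => measure_congr (hY₀ae i)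
  have hYV : ∀ i, Y i ⊆ V i := fun i => (hY i (Finset.mem_univ i)).2
  have hmassV : mass Finset.univ V ≠ ∞ := ENNReal.sum_ne_top.2 fun i _ => hVt i
  have hmassfin : mass Finset.univ Y₀ ≠ ∞ := ne_top_of_le_ne_top hmassV
    (Finset.sum_le_sum fun i _ => measure_mono ((hY₀Y i).trans (hYV i)))
  obtain ⟨Y', 𝒬, a, m, m', t, hY'm, hY'Y₀, hY'𝒬, h𝒬0, ha, hm', h𝒬, hmassY'⟩ :=
    exists_uniform_refinement p hY₀m hmassfin
      (fun i x hx => h𝒢 i x (hYV i (hY₀Y i hx))) h𝒢card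
  rw [hmassY₀] at hmassY'
  set L : ℕ := (Nat.log 2 n + 1) ^ 2 * (2 * (Nat.log 2 (2 * n * N) + 1) * (Nat.log 2 n + 1)) with hL
  have hLℓ : (L : ℝ) ≤ 2 * ℓ ^ 4 := by
    rw [hL]; push_cast
    calc ((Nat.log 2 n : ℝ) + 1) ^ 2 * (2 * (Nat.log 2 (2 * n * N) + 1) * (Nat.log 2 n + 1))
        ≤ ℓ ^ 2 * (2 * ℓ * ℓ) := by
          gcongr <;> linarith
      _ = _ := by ring
  have hLE : (L : ℝ≥0∞) ≤ ENNReal.ofReal (2 * ℓ ^ 4) := by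
    rw [← ENNReal.ofReal_natCast]; exact ENNReal.ofReal_le_ofReal hLℓ
  have hY'V : ∀ i, Y' i ⊆ V i := fun i => (hY'Y₀ i).trans ((hY₀Y i).trans (hYV i))
  -- the subfamilies
  set W' : Finset κ := Finset.univ.filter fun j => (𝒬 j).Nonempty with hW'
  set V' : Finset ι := Finset.univ.filter fun i => p i ∈ W' with hV'
  set YW : κ → Set E3 := fun j => {x | gridIndex s x ∈ 𝒬 j} with hYW
  have hmemW' : ∀ j, j ∈ W' ↔ (𝒬 j).Nonempty := fun j => by simp [hW']
  have hmemV' : ∀ i, i ∈ V' ↔ p i ∈ W' := fun i => by simp [hV']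
  have hpart : ∀ j ∈ W', part V' p j = part Finset.univ p j := by
    intro j hj
    ext i
    rw [mem_part, mem_part, hmemV']
    constructor
    · rintro ⟨-, h⟩; exact ⟨Finset.mem_univ i, h⟩
    · rintro ⟨-, h⟩; exact ⟨h ▸ hj, h⟩
  have hmemV'' : ∀ i, ∀ x ∈ Y' i, i ∈ V' := fun i x hx =>
    (hmemV' i).2 ((hmemW' _).2 ⟨_, hY'𝒬 i x hx⟩)
  have hunion : shadedUnion V' Y' = shadedUnion Finset.univ Y' := by
    ext x
    rw [mem_shadedUnion, mem_shadedUnion]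
    constructor
    · rintro ⟨i, -, h⟩; exact ⟨i, Finset.mem_univ i, h⟩
    · rintro ⟨i, -, h⟩; exact ⟨i, hmemV'' i x h, h⟩
  have hmassV' : mass V' Y' = mass Finset.univ Y' := by
    refine Finset.sum_subset (Finset.subset_univ _) fun i _ hi => ?_
    have : Y' i = ∅ := Set.eq_empty_iff_forall_notMem.2 fun x hx => hi (hmemV'' i x hx)
    rw [this, measure_empty]
  have hmassW' : mass Finset.univ Y' = ∑ j ∈ W', mass (part Finset.univ p j) Y' := by
    rw [← hmassV']
    simp only [mass, part]
    rw [← Finset.sum_fiberwise_of_maps_to (s := V') (t := W') (g := p)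
      (fun i hi => (hmemV' i).1 hi)]
    refine Finset.sum_congr rfl fun j hj => Finset.sum_congr ?_ fun _ _ => rfl
    ext i
    simp only [Finset.mem_filter, hmemV', Finset.mem_univ, true_and, and_iff_right_iff_imp]
    intro h; rwa [h]
  have hYWm : ∀ j, MeasurableSet (YW j) := fun j =>
    measurable_gridIndex s (MeasurableSet.of_discrete (s := (𝒬 j : Set (Fin 3 → ℤ))))
  have hYWthick : ∀ j ∈ W', YW j ⊆ Metric.thickening (2 * s) (partUnion p Y' j) := by
    intro j _ x hx
    obtain ⟨y, hy, hyz⟩ := nonempty_of_measure_ne_zero (h𝒬0 j _ hx)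
    exact Metric.mem_thickening_iff.2 ⟨y, hy, dist_lt_of_gridIndex_eq hs (Eq.symm hyz)⟩
  have hpartW : ∀ j, partUnion p Y' j ⊆ W j := by
    intro j x hx
    obtain ⟨i, rfl, hxi⟩ := mem_partUnion.1 hx
    exact hVW i (hY'V i hxi)
  have hYWW : ∀ j ∈ W', YW j ⊆ Metric.thickening (2 * s) (W j) := fun j hj =>
    (hYWthick j hj).trans (Metric.thickening_subset_of_subset _ (hpartW j))
  have hthick : ∀ j, volume (Metric.thickening (2 * s) (W j))
      ≤ ENNReal.ofReal (27000 * A ^ 9) * refVolume A w := by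
    intro j
    rw [← hsw]; exact (hdW j).volume_thickening_le_refVolume hA (hapW j)
  have hthickt : ∀ j, volume (Metric.thickening (2 * s) (W j)) ≠ ∞ := fun j =>
    ne_top_of_le_ne_top (ENNReal.mul_ne_top ENNReal.ofReal_ne_top refVolume_ne_top) (hthick j)
  have hthick0 : ∀ j, volume (Metric.thickening (2 * s) (W j)) ≠ 0 := fun j h =>
    hW0 j (measure_mono_null (Metric.self_subset_thickening (by positivity) _) h)
  have hW'ne : W'.Nonempty := by
    rw [Finset.nonempty_iff_ne_empty]
    intro h0
    rw [hmassW', h0, Finset.sum_empty, mul_zero, nonpos_iff_eq_zero] at hmassY'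
    exact hmass hmassY'
  have hmultYW : ∀ x, multiplicityAt W' YW x = (Finset.univ.filter fun j =>
      gridIndex s x ∈ 𝒬 j).card := by
    intro x
    rw [multiplicityAt_eq_card]
    congr 1
    ext j
    exact ⟨fun h => Finset.mem_filter.2 ⟨Finset.mem_univ j, (Finset.mem_filter.1 h).2⟩,
      fun h => Finset.mem_filter.2
        ⟨(hmemW' j).2 ⟨_, (Finset.mem_filter.1 h).2⟩, (Finset.mem_filter.1 h).2⟩⟩
  have hconstW : HasConstantMultiplicity 2 m W' YW := by
    intro x hx
    obtain ⟨j, -, hxj⟩ := mem_shadedUnion.1 hx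
    rw [hmultYW]
    exact (h𝒬 j _ hxj).1
  have hincident : ∀ x ∈ shadedUnion V' Y',
      incident V' Y' x ⊆ ⋃ j ∈ incident W' YW x, incident (part V' p j) Y' x := by
    rintro x - i ⟨hi, hxi⟩
    simp only [Set.mem_iUnion]
    exact ⟨p i, ⟨(hmemV' i).1 hi, hY'𝒬 i x hxi⟩, mem_part.2 ⟨hi, rfl⟩, hxi⟩
  have hℓ0 : 0 < ℓ := by linarith
  have hΛ1 : (8 * ℓ ^ 4 : ℝ) ≤ 27000 * 16 * 2228224 * 1000 ^ 2 * A ^ 22 * ℓ ^ 9 := by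
    have h1 : ℓ ^ 4 ≤ ℓ ^ 9 := pow_le_pow_right₀ (by linarith) (by norm_num)
    have h2 : 1 ≤ A ^ 22 := one_le_pow₀ hA
    have h3 : 0 < ℓ ^ 9 := by positivity
    nlinarith [mul_le_mul h2 h1 (by positivity) (by positivity)]
  refine ⟨_, rfl, hρ1, V', Y', W', YW, fun i hi => (hmemV' i).1 hi,
    fun i _ => ⟨(hY'm i).nullMeasurableSet, hY'V i⟩,
    fun j hj => ⟨(hYWm j).nullMeasurableSet, hYWW j hj⟩, ?_,
    ⟨Finset.subset_univ _, fun i _ => (hY'Y₀ i).trans (hY₀Y i)⟩, ?_, ?_,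
    ⟨m, hconstW.mono (by norm_num)⟩, ⟨m', fun j hj => ?_⟩, ?_, hincident, ?_⟩
  · intro j hj
    rw [hpart j hj]; exact hYWthick j hj
  · -- mass of the refinement
    rw [hmassV']
    refine hmassY'.trans ?_
    gcongr
    refine hLE.trans (ENNReal.ofReal_le_ofReal (le_trans ?_ hΛ1))
    have : 0 < ℓ ^ 4 := by positivity
    linarith
  · -- density of the shading of the neighbourhoods
    set τ : ℝ≥0∞ := a * refVolume A v with hτ
    have ha0 : a ≠ 0 := by
      obtain ⟨j, hj⟩ := hW'ne
      have h1 := ha j ((hmemW' j).1 hj)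
      obtain ⟨z, hz⟩ := (hmemW' j).1 hj
      obtain ⟨x, hx, -⟩ := nonempty_of_measure_ne_zero (h𝒬0 j z hz)
      obtain ⟨i, hi, -⟩ := mem_partUnion.1 hx
      have h2 : 0 < (part Finset.univ p j).card :=
        Finset.card_pos.2 ⟨i, mem_part.2 ⟨Finset.mem_univ i, hi⟩⟩
      omega
    have hTlow : ∀ j ∈ W', τ ≤ mass (part Finset.univ p j) V := by
      intro j hj
      calc τ ≤ (part Finset.univ p j).card * refVolume A v := by
            rw [hτ]; gcongr; exact (ha j ((hmemW' j).1 hj)).1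
        _ = ∑ _i ∈ part Finset.univ p j, refVolume A v := by
            rw [Finset.sum_const, nsmul_eq_mul]
        _ ≤ _ := Finset.sum_le_sum fun i _ => (hdV i).refVolume_le (hVconv i) hA (hapV i)
    have hThigh : ∀ j ∈ W', mass (part Finset.univ p j) V
        ≤ ENNReal.ofReal (2 * (1000 * A ^ 6)) * τ := by
      intro j hj
      calc mass (part Finset.univ p j) V
          ≤ ∑ _i ∈ part Finset.univ p j, ENNReal.ofReal (1000 * A ^ 6) * refVolume A v :=
            Finset.sum_le_sum fun i _ => (hdV i).volume_le_refVolume hA (hapV i)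
        _ = (part Finset.univ p j).card * (ENNReal.ofReal (1000 * A ^ 6) * refVolume A v) := by
            rw [Finset.sum_const, nsmul_eq_mul]
        _ ≤ (2 * a : ℕ) * (ENNReal.ofReal (1000 * A ^ 6) * refVolume A v) := by
            gcongr; exact (ha j ((hmemW' j).1 hj)).2
        _ = _ := by
            rw [ENNReal.ofReal_mul (p := 2) (by norm_num), ENNReal.ofReal_ofNat, hτ]; push_cast; ring
    have hTsum : W'.card * τ ≤ mass Finset.univ V := by
      calc W'.card * τ = ∑ _j ∈ W', τ := by rw [Finset.sum_const, nsmul_eq_mul]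
        _ ≤ ∑ j ∈ W', mass (part Finset.univ p j) V := Finset.sum_le_sum hTlow
        _ ≤ ∑ j, mass (part Finset.univ p j) V := Finset.sum_le_sum_of_subset (Finset.subset_univ _)
        _ = mass Finset.univ V := by
            simp only [mass, part]
            exact Finset.sum_fiberwise _ _ _
    have hcord : ∀ j ∈ W', mass (part Finset.univ p j) Y' ^ 2 * refVolume A w
        ≤ ((k₀ + 1) * ENNReal.ofReal (2228224 * A)) * C *
          (ENNReal.ofReal (2 * (1000 * A ^ 6)) * τ) ^ 2 * volume (YW j) := by
      intro j hj
      have hne : (part Finset.univ p j).Nonempty := by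
        rw [← Finset.card_pos]
        have := (ha j ((hmemW' j).1 hj)).1
        omega
      have h1 := mass_sq_mul_volume_le (Y := Y') (hF j) (fun i _ => hVconv i) (hWconv j)
        (fun i hi => (mem_part.1 hi).2 ▸ hVW i) (fun i _ => hV0 i) (fun i _ => hVt i) (hW0 j)
        (hWt j) hne hs (he j) hA0.le (heslab j) (fun i _ => hdist i) hk₀R (𝒬 := 𝒬 j)
        (fun i _ => hY'V i) (fun i hi x hx => (mem_part.1 hi).2 ▸ hY'𝒬 i x hx)
      calc mass (part Finset.univ p j) Y' ^ 2 * refVolume A w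
          ≤ mass (part Finset.univ p j) Y' ^ 2 * volume (W j) := by
            gcongr; exact (hdW j).refVolume_le (hWconv j) hA (hapW j)
        _ ≤ _ := h1
        _ ≤ _ := by
            gcongr
            exact hThigh j hj
    obtain ⟨j₀, hj₀⟩ := hW'ne
    have key := inv_mul_sq_le_of_forall ⟨j₀, hj₀⟩ hcord (hmassW' ▸ hmassY') hTsum
      (mul_ne_zero (by exact_mod_cast ha0) (refVolume_ne_zero hA hv))
      (ENNReal.mul_ne_top (ENNReal.natCast_ne_top _) refVolume_ne_top)
      (fun j _ => hthick j)
      (fun h => hthick0 j₀ (Finset.sum_eq_zero_iff.1 h j₀ hj₀))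
      (ENNReal.sum_ne_top.2 fun j _ => hthickt j)
    refine key.trans ?_
    gcongr ?_ * _
    have hk : ((k₀ : ℝ≥0∞) + 1) ≤ ENNReal.ofReal ℓ := by
      have h1 : ((k₀ + 1 : ℕ) : ℝ) ≤ ℓ := by rw [hk₀]; push_cast; linarith
      have h2 := ENNReal.ofReal_le_ofReal h1
      rw [ENNReal.ofReal_natCast] at h2
      exact_mod_cast h2
    calc (L : ℝ≥0∞) ^ 2 * ((k₀ + 1) * ENNReal.ofReal (2228224 * A)) *
          ENNReal.ofReal (2 * (1000 * A ^ 6)) ^ 2 * ENNReal.ofReal (27000 * A ^ 9)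
        ≤ ENNReal.ofReal (2 * ℓ ^ 4) ^ 2 * (ENNReal.ofReal ℓ * ENNReal.ofReal (2228224 * A)) *
          ENNReal.ofReal (2 * (1000 * A ^ 6)) ^ 2 * ENNReal.ofReal (27000 * A ^ 9) := by gcongr
      _ = _ := by
          rw [← ENNReal.ofReal_pow (by positivity), ← ENNReal.ofReal_pow (by positivity),
            ← ENNReal.ofReal_mul (by positivity), ← ENNReal.ofReal_mul (by positivity),
            ← ENNReal.ofReal_mul (by positivity), ← ENNReal.ofReal_mul (by positivity)]
          congr 1; ring
  · rw [hpart j hj]; exact (hm' j).mono (by norm_num)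
  · -- multiplicities
    intro j hj
    rw [hpart j hj]
    obtain ⟨z, hz⟩ := (hmemW' j).1 hj
    have hpu0 : volume (shadedUnion (part Finset.univ p j) Y') ≠ 0 := fun h =>
      h𝒬0 j z hz (measure_mono_null Set.inter_subset_left h)
    have hput : volume (shadedUnion (part Finset.univ p j) Y') ≠ ∞ :=
      ne_top_of_le_ne_top (hWt j) (measure_mono (hpartW j))
    have hm'le : (m' : ℝ≥0∞) ≤ avgMultiplicity (part Finset.univ p j) Y' := by
      rw [avgMultiplicity, ENNReal.le_div_iff_mul_le (Or.inl hpu0) (Or.inl hput)]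
      exact mul_volume_le_mass (fun i _ => hY'm i) fun x hx => (hm' j x hx).1
    have hWu0 : volume (shadedUnion W' YW) ≠ 0 := fun h => hpu0 <| by
      refine measure_mono_null ?_ h
      intro x hx
      obtain ⟨i, hi, hxi⟩ := mem_partUnion.1 hx
      exact mem_shadedUnion.2 ⟨j, hj, hi ▸ hY'𝒬 i x hxi⟩
    have hWut : volume (shadedUnion W' YW) ≠ ∞ :=
      ne_top_of_le_ne_top (ENNReal.sum_ne_top.2 fun j _ => hthickt j)
        ((volume_shadedUnion_le_mass _ _).trans
          (Finset.sum_le_sum fun j hj => measure_mono (hYWW j hj)))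
    have hmle : (m : ℝ≥0∞) ≤ avgMultiplicity W' YW := by
      rw [avgMultiplicity, ENNReal.le_div_iff_mul_le (Or.inl hWu0) (Or.inl hWut)]
      exact mul_volume_le_mass (fun i _ => hYWm i) fun x hx => (hconstW x hx).1
    have hmultV' : ∀ x ∈ shadedUnion V' Y', multiplicityAt V' Y' x ≤ 2 * m * (2 * m') := by
      intro x hx
      rw [multiplicityAt_eq_card]
      have hsub : (V'.filter fun i => x ∈ Y' i) ⊆ (W'.filter fun j => x ∈ YW j).biUnion
          fun j => (part Finset.univ p j).filter fun i => x ∈ Y' i := by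
        intro i hi
        obtain ⟨h1, h2⟩ := Finset.mem_filter.1 hi
        exact Finset.mem_biUnion.2 ⟨p i, Finset.mem_filter.2 ⟨(hmemV' i).1 h1, hY'𝒬 i x h2⟩,
          Finset.mem_filter.2 ⟨mem_part.2 ⟨Finset.mem_univ i, rfl⟩, h2⟩⟩
      refine (Finset.card_le_card hsub).trans
        ((Finset.card_biUnion_le_card_mul _ _ (2 * m') fun j _ => ?_).trans ?_)
      · rw [← multiplicityAt_eq_card]
        by_cases h0 : x ∈ shadedUnion (part Finset.univ p j) Y'
        · exact (hm' j x h0).2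
        · rw [not_not.1 (mt multiplicityAt_ne_zero.1 h0)]; exact Nat.zero_le _
      · rw [← multiplicityAt_eq_card]
        gcongr
        obtain ⟨i, hi, hxi⟩ := mem_shadedUnion.1 hx
        exact (hconstW x (mem_shadedUnion.2 ⟨p i, (hmemV' i).1 hi, hY'𝒬 i x hxi⟩)).2
    have h1 := mass_le_mul_volume (fun i _ => hY'm i) hmultV'
    rw [hmassV'] at h1
    have hsubU : shadedUnion V' Y' ⊆ shadedUnion Finset.univ Y := by
      intro x hx
      obtain ⟨i, -, hxi⟩ := mem_shadedUnion.1 hx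
      exact mem_shadedUnion.2 ⟨i, Finset.mem_univ i, hY₀Y i (hY'Y₀ i hxi)⟩
    calc avgMultiplicity Finset.univ Y ≤ L * (2 * m * (2 * m') : ℕ) := by
          rw [avgMultiplicity]
          refine ENNReal.div_le_of_le_mul ?_
          refine hmassY'.trans ?_
          rw [mul_assoc]
          gcongr
          exact h1.trans (by gcongr)
      _ = 4 * L * (m * m') := by push_cast; ring
      _ ≤ _ := by
          gcongr
          refine le_trans ?_ (ENNReal.ofReal_le_ofReal hΛ1)
          rw [show (8 * ℓ ^ 4 : ℝ) = 4 * (2 * ℓ ^ 4) by ring, ENNReal.ofReal_mul (by norm_num),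
            ENNReal.ofReal_ofNat]
          gcongr
  · -- volume of the shaded union in balls
    intro x _ y hy
    obtain ⟨j, -, hyj⟩ := mem_shadedUnion.1 hy
    rw [hunion]
    have := volume_inter_ball_le hs (U := shadedUnion Finset.univ Y') (t := t)
      (𝒬 := {z | ∃ j, z ∈ 𝒬 j})
      (fun x hx => by
        obtain ⟨i, -, hxi⟩ := mem_shadedUnion.1 hx
        exact ⟨p i, hY'𝒬 i x hxi⟩)
      (fun z ⟨j, hz⟩ => (h𝒬 j z hz).2.1) (fun z ⟨j, hz⟩ => (h𝒬 j z hz).2.2) x ⟨j, hyj⟩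
    exact_mod_cast this

theorem proposition4p1 :
    -- `K₀` is the factor in "roughly the same"; `A` is the factor in "approximately the same
    -- dimensions"; `K ε` is the constant in `⪅`.
    ∃ K₀ : ℕ, ∀ A : ℝ, 1 ≤ A → ∃ K : ℝ → ℝ,
    ∀ (ι κ : Type*) [Fintype ι] [Fintype κ]
      (V : ι → Set E3) (W : κ → Set E3) (p : ι → κ) (Y : ι → Set E3)
      (v w : Fin 3 → ℝ) (C : ℝ≥0) (ρ : ℝ),
      -- families of convex sets, with `𝕍 = ⊔ 𝕍_W` and every member of `𝕍_W` contained in `W`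
      (∀ i, Convex ℝ (V i)) → (∀ j, Convex ℝ (W j)) → (∀ i, V i ⊆ W (p i)) →
      -- `0 < ρ ≤ 1 / |𝕍|`, and `ρ` is at most the ratio of the shortest to the longest
      -- dimension of each member of `𝕍`; the dimensions are about `v`, resp. `w`
      0 < ρ → ρ * Fintype.card ι ≤ 1 →
      (∀ i, ∃ d, HasDimensions (V i) d ∧ ApproxDimensions A v d ∧ ρ ≤ d 0 / d 2) →
      (∀ j, ∃ d, HasDimensions (W j) d ∧ ApproxDimensions A w d) →
      -- each `𝕍_W` is `C`-Frostman in `W`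
      (∀ j, frostmanConstant (part Finset.univ p j) V (W j) ≤ C) →
      IsShading Finset.univ V Y →
      ∃ (V' : Finset ι) (Y' : ι → Set E3) (W' : Finset κ) (YW : κ → Set E3),
        (∀ i ∈ V', p i ∈ W') ∧
        IsShading V' V Y' ∧
        -- `YW` is a shading of the `w₁`-neighbourhoods of the members of `𝕎'`, and is
        -- supported within `w₁` of the shading `Y'`
        IsShading W' (fun j => Metric.thickening (w 0) (W j)) YW ∧
        (∀ j ∈ W', YW j ⊆ Metric.thickening (w 0) (shadedUnion (part V' p j) Y')) ∧
        -- `(𝕍', Y')` is a `⪆ 1` refinement of `(𝕍, Y)`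
        IsRefinement V' Y' Finset.univ Y ∧
        LessApprox K ρ (mass Finset.univ Y) (mass V' Y') ∧
        -- `λ(𝕎', Y_𝕎') ⪆ C⁻¹ λ(𝕍, Y)²`
        LessApprox K ρ ((C : ℝ≥0∞)⁻¹ * shadingDensity Finset.univ V Y ^ 2)
          (shadingDensity W' (fun j => Metric.thickening (w 0) (W j)) YW) ∧
        -- `(𝕎', Y_𝕎')` has constant multiplicity
        (∃ m : ℕ, HasConstantMultiplicity K₀ m W' YW) ∧
        -- each `(𝕍'_W, Y')` has constant multiplicity, the same for all `W ∈ 𝕎'`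
        (∃ m : ℕ, ∀ j ∈ W', HasConstantMultiplicity K₀ m (part V' p j) Y') ∧
        -- `μ(𝕍, Y) ⪅ μ(𝕎', Y_𝕎') μ(𝕍'_W, Y')` for all `W ∈ 𝕎'`
        (∀ j ∈ W', LessApprox K ρ (avgMultiplicity Finset.univ Y)
          (avgMultiplicity W' YW * avgMultiplicity (part V' p j) Y')) ∧
        -- pointwise containment
        (∀ x ∈ shadedUnion V' Y',
          incident V' Y' x ⊆ ⋃ j ∈ incident W' YW x, incident (part V' p j) Y' x) ∧
        -- `|U(𝕍', Y') ∩ B(x, w₁)|` is roughly the same for all `x ∈ U(𝕎', Y_𝕎')`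
        (∀ x ∈ shadedUnion W' YW, ∀ y ∈ shadedUnion W' YW,
          volume (shadedUnion V' Y' ∩ Metric.ball x (w 0)) ≤
            (K₀ : ℝ≥0∞) * volume (shadedUnion V' Y' ∩ Metric.ball y (w 0))) := by
  refine ⟨250, fun A hA => ?_⟩
  obtain ⟨K, hK⟩ := exists_logLoss_le_rpow hA
    (c := 27000 * 16 * 2228224 * 1000 ^ 2 * A ^ 22) (by positivity)
  refine ⟨K, fun ι κ _ _ V W p Y v w C ρ hVconv hWconv hVW hρ hρι hVd hWd hF hY => ?_⟩
  by_cases hmass : mass Finset.univ Y = 0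
  · -- a shading of mass zero is refined to the empty family
    refine ⟨∅, fun _ => ∅, ∅, fun _ => ∅, by simp, by simp [IsShading], by simp [IsShading],
      by simp, by simp [IsRefinement], ?_, ?_, ⟨0, ?_⟩, ⟨0, by simp⟩, by simp,
      by simp [shadedUnion], by simp [shadedUnion]⟩
    · intro ε _; rw [hmass]; exact zero_le
    · intro ε _; rw [shadingDensity, hmass]; simp
    · intro x hx; simp [shadedUnion] at hx
  · obtain ⟨Λ, hΛ, hρ1, V', Y', W', YW, h1, h2, h3, h4, h5, h6, h7, h8, h9, h10, h11, h12⟩ :=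
      exists_refinement_of_mass_ne_zero hA hVconv hWconv hVW hρ hρι hVd hWd hF hY hmass
    have hΛK : ∀ ε : ℝ, 0 < ε → Λ ≤ ENNReal.ofReal (K ε * ρ ^ (-ε)) := fun ε hε => by
      rw [hΛ]; exact ENNReal.ofReal_le_ofReal (hK ρ hρ hρ1 ε hε)
    refine ⟨V', Y', W', YW, h1, h2, h3, h4, h5, fun ε hε => h6.trans ?_,
      fun ε hε => h7.trans ?_, h8, h9, fun j hj ε hε => (h10 j hj).trans ?_, h11, h12⟩
    all_goals
      gcongr
      exact hΛK ε hε
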